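/- **Setting.** A *GPT* $\mathcal A=(A,\Omega_A,E_A)$ consists of a finite-dimensional real vector space $A$, a compact convex set of effects $E_A\subset A$ that spans $A$ and contains a unit effect $u_A$ with $u_A-e\in E_A$ for all $e\in E_A$, and a nonempty compact convex set of normalized states $\Omega_A\subset A^*$ that spans $A^*$, with $\omega(u_A)=1$ and $(\omega,e):=\omega(e)\in[0,1]$ for all $\omega\in\Omega_A$, $e\in E_A$. Let $\bar E_A$ be the set of all $e\in A$ with $0\le\omega(e)\le1$ for all $\omega\in\Omega_A$. The quantum system $\mathcal Q_n$ has the Hermitian complex $n\times n$ matrices as effect space and as state space, density matrices as normalized states, matrices $0\le E\le \mathbf 1$ as effects, and $(\rho,E)=\operatorname{tr}(\rho E)$. The quantum system $\mathcal Q_\infty$ on a separable Hilbert space $\mathcal H$ is defined likewise, with the bounded self-adjoint operators as effect space and the self-adjoint trace-class operators as state space. For $\varepsilon\in\mathbb R$, an *$\varepsilon$-embedding* of $\mathcal A$ into a system $\mathcal B$ is a pair of linear maps, $\Phi$ from $A$ to the effect space and $\Psi$ from $A^*$ to the state space of $\mathcal B$, that map effects to effects and normalized states to normalized states and satisfy $|(\omega,e)-(\Psi(\omega),\Phi(e))|\le\varepsilon$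 for all $e\in E_A$, $\omega\in\Omega_A$. A *bipartite state* on $\mathcal{AA}$ is a bilinear map $\omega_{AA}:A\times A\to\mathbb R$ with $\omega_{AA}(u_A,u_A)=1$ and $\omega_{AA}(e,f)\ge0$ for all $e,f\in\bar E_A$. Its robustness of entanglement is $$\mathcal R(\omega_{AA})=\tfrac12\inf\Big\{\sum_{i=1}^n|\lambda_i| \;\Big|\; n\in\mathbb N,\ \omega_{AA}=\sum_{i=1}^n\lambda_i\,\varphi_i\otimes\psi_i,\ \varphi_i,\psi_i\in\Omega_A,\ \sum_{i=1}^n\lambda_i=1\Big\}-\tfrac12,$$ and the self-entangleability of $\mathcal A$ is $\mathcal R(\mathcal A)=\max_{\omega_{AA}}\mathcal R(\omega_{AA})$, the maximum being over all bipartite states on $\mathcal{AA}$. Let $X,Y$ (settings) and $X',Y'$ (outcomes) be finite sets. A *behaviour* on $\mathcal{AA}$ is a table $P(a,b|x,y)=\omega_{AA}(e_{a|x},f_{b|y})$ ($a\in X'$, $b\in Y'$, $x\in X$, $y\in Y$), with $\omega_{AA}$ a bipartite state and effects $e_{a|x},f_{b|y}\in E_A$ such that $\sum_a e_{a|x}=u_A$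 for all $x$ and $\sum_b f_{b|y}=u_A$ for all $y$. A *quantum behaviour* is a table $P_Q(a,b|x,y)=\operatorname{tr}(\rho\,(e_{a|x}\otimes f_{b|y}))$ with $\rho$ a density matrix on the tensor product of two finite-dimensional Hilbert spaces, of any dimensions, and $(e_{a|x})_a$, $(f_{b|y})_b$ POVMs on the two factors. For a *Bell functional* $B[P]=\sum_{a,b,x,y}b_{a,b,x,y}P(a,b|x,y)$ with real coefficients, let $|B|=\sum_{a,b,x,y}|b_{a,b,x,y}|$, let $B_{\mathcal{AA}}$ be the maximum of $B[P]$ over all behaviours on $\mathcal{AA}$, and let $B_{\mathcal Q}$ be the supremum of $B[P_Q]$ over all quantum behaviours. **Theorem.** Let $\mathcal A$ be a GPT and $B$ a Bell functional with $B_{\mathcal{AA}}>B_{\mathcal Q}$. Then, for every $$\varepsilon<\frac{B_{\mathcal{AA}}-B_{\mathcal Q}}{4|B|\,(1+2\,\mathcal R(\mathcal A))},$$ the GPT $\mathcal A$ cannot be $\varepsilon$-embedded into any $\mathcal Q_n$ ($n\in\mathbb N$), nor into $\mathcal Q_\infty$ on any separable Hilbert space. -/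

import Mathlib

open scoped Kronecker InnerProductSpace ComplexOrder

noncomputable section

namespace GPTTheory

/-- The data of a (possibly infinite-dimensional) physical system in the framework of generalized
probabilistic theories: a real vector space `V` that contains the effects, a real vector space `W`
that contains the states, the set of normalized states, the set of effects, and the number
`prob ω e = (ω, e)`, the probability of the effect `e` in the state `ω`. -/
structure ProbSystem (V W : Type*) where
  states : Set W
  effects : Set V
  prob : W → V → ℝ

/-- An `ε`-embedding of one system into another: a pair of linear maps, `Φ` on the effect space and
`Ψ` on the state space, that map effects to effects, normalized states to normalized states, and
preserve all outcome probabilities up to `ε`. -/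
structure IsEmbedding {V W V' W' : Type*} [AddCommGroup V] [Module ℝ V] [AddCommGroup W]
    [Module ℝ W] [AddCommGroup V'] [Module ℝ V'] [AddCommGroup W'] [Module ℝ W']
    (S : ProbSystem V W) (T : ProbSystem V' W') (ε : ℝ) (Φ : V →ₗ[ℝ] V') (Ψ : W →ₗ[ℝ] W') :
    Prop where
  map_effects : ∀ e ∈ S.effects, Φ e ∈ T.effects
  map_states : ∀ ω ∈ S.states, Ψ ω ∈ T.states
  prob_close : ∀ e ∈ S.effects, ∀ ω ∈ S.states, |S.prob ω e - T.prob (Ψ ω) (Φ e)| ≤ ε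

/-- `S` can be `ε`-embedded into `T`. -/
def Embeddable {V W V' W' : Type*} [AddCommGroup V] [Module ℝ V] [AddCommGroup W]
    [Module ℝ W] [AddCommGroup V'] [Module ℝ V'] [AddCommGroup W'] [Module ℝ W']
    (S : ProbSystem V W) (T : ProbSystem V' W') (ε : ℝ) : Prop :=
  ∃ (Φ : V →ₗ[ℝ] V') (Ψ : W →ₗ[ℝ] W'), IsEmbedding S T ε Φ Ψ

/-- A generalized probabilistic theory `(A, Ω_A, E_A)` on a finite-dimensional real vector space `A`
(the norm on `A` serves only to provide the unique Hausdorff vector space topology).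
The state space is a subset of the dual space of `A`; states and effects separate each other, that
is, the effects span `A` and the states span the dual space. -/
structure GPT (A : Type*) [NormedAddCommGroup A] [NormedSpace ℝ A] [FiniteDimensional ℝ A] where
  /-- the set `E_A` of effects -/
  effects : Set A
  /-- the set `Ω_A` of normalized states -/
  states : Set (StrongDual ℝ A)
  /-- the unit effect `u_A` -/
  unit : A
  convex_effects : Convex ℝ effects
  isCompact_effects : IsCompact effects
  span_effects : Submodule.span ℝ effects = ⊤
  unit_mem : unit ∈ effects
  unit_sub_mem : ∀ e ∈ effects, unit - e ∈ effects
  convex_states : Convex ℝ states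
  isCompact_states : IsCompact states
  states_nonempty : states.Nonempty
  span_states : Submodule.span ℝ states = ⊤
  state_apply_unit : ∀ ω ∈ states, ω unit = 1
  state_apply_mem : ∀ ω ∈ states, ∀ e ∈ effects, ω e ∈ Set.Icc (0 : ℝ) 1

section Bipartite

variable {A B : Type*} [NormedAddCommGroup A] [NormedSpace ℝ A] [FiniteDimensional ℝ A]
  [NormedAddCommGroup B] [NormedSpace ℝ B] [FiniteDimensional ℝ B]

/-- The system described by a GPT, with `(ω, e) = ω e`. -/
def GPT.toSystem (G : GPT A) : ProbSystem A (StrongDual ℝ A) where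
  states := G.states
  effects := G.effects
  prob ω e := ω e

/-- The set `Ē_A` of all vectors on which every state takes a value in `[0, 1]`. -/
def GPT.extendedEffects (G : GPT A) : Set A :=
  {e | ∀ ω ∈ G.states, ω e ∈ Set.Icc (0 : ℝ) 1}

/-- Bipartite states on a pair of GPTs (the maximal tensor product): normalized bilinear forms that
are nonnegative on all pairs of elements of `Ē_A` and `Ē_B`. -/
structure IsBipartiteState (G : GPT A) (K : GPT B) (ω : A →ₗ[ℝ] B →ₗ[ℝ] ℝ) : Prop where
  normalized : ω G.unit K.unit = 1
  nonneg : ∀ e ∈ G.extendedEffects, ∀ f ∈ K.extendedEffects, 0 ≤ ω e f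

/-- The set of all numbers `∑ |λ_i|`, for all finite decompositions `ω = ∑ λ_i φ_i ⊗ ψ_i` into
product states, where `∑ λ_i = 1`. -/
def decompositionWeights (G : GPT A) (K : GPT B) (ω : A →ₗ[ℝ] B →ₗ[ℝ] ℝ) : Set ℝ :=
  {r | ∃ (n : ℕ) (c : Fin n → ℝ) (φ : Fin n → StrongDual ℝ A) (ψ : Fin n → StrongDual ℝ B),
    (∀ i, φ i ∈ G.states) ∧ (∀ i, ψ i ∈ K.states) ∧
    (∀ a b, ω a b = ∑ i, c i * (φ i a * ψ i b)) ∧ ∑ i, c i = 1 ∧ r = ∑ i, |c i|}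

/-- Robustness of entanglement of a bipartite state. -/
def robustness (G : GPT A) (K : GPT B) (ω : A →ₗ[ℝ] B →ₗ[ℝ] ℝ) : ℝ :=
  1 / 2 * sInf (decompositionWeights G K ω) - 1 / 2

/-- The self-entangleability of a GPT: the maximal robustness of entanglement of the bipartite
states on two copies of it. -/
def selfEntangleability (G : GPT A) : ℝ :=
  sSup {r | ∃ ω : A →ₗ[ℝ] A →ₗ[ℝ] ℝ, IsBipartiteState G G ω ∧ r = robustness G G ω}

/-- A family of measurements with settings in `X` and outcomes in `X'`: for each `x`, the effects
`e a x`, where `a` runs over the outcomes, sum up to the unit effect. -/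
def GPT.IsMeasurementFamily (G : GPT A) {X X' : Type*} [Fintype X'] (e : X' → X → A) : Prop :=
  (∀ a x, e a x ∈ G.effects) ∧ ∀ x, ∑ a, e a x = G.unit

/-- Behaviours on a pair of GPTs: the probability tables `P(a, b | x, y) = ω(e_{a|x}, f_{b|y})`,
written here as `P a b x y`. -/
def IsBehaviour (G : GPT A) (K : GPT B) {X Y X' Y' : Type*} [Fintype X'] [Fintype Y']
    (P : X' → Y' → X → Y → ℝ) : Prop :=
  ∃ (ω : A →ₗ[ℝ] B →ₗ[ℝ] ℝ) (e : X' → X → A) (f : Y' → Y → B),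
    IsBipartiteState G K ω ∧ G.IsMeasurementFamily e ∧ K.IsMeasurementFamily f ∧
    ∀ a b x y, P a b x y = ω (e a x) (f b y)

end Bipartite

/-! ### Quantum systems -/

/-- The `n`-level quantum system: states are the density matrices, effects the Hermitian matrices
`E` with `0 ≤ E ≤ 1`, both in the real vector space of Hermitian matrices, and `(ρ, E) = tr (ρ E)`. -/
def quantumSystem (n : ℕ) :
    ProbSystem (selfAdjoint (Matrix (Fin n) (Fin n) ℂ))
      (selfAdjoint (Matrix (Fin n) (Fin n) ℂ)) where
  states := {ρ | (ρ : Matrix (Fin n) (Fin n) ℂ).PosSemidef ∧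
    (ρ : Matrix (Fin n) (Fin n) ℂ).trace = 1}
  effects := {E | (E : Matrix (Fin n) (Fin n) ℂ).PosSemidef ∧
    (1 - (E : Matrix (Fin n) (Fin n) ℂ)).PosSemidef}
  prob ρ E := ((ρ : Matrix (Fin n) (Fin n) ℂ) * (E : Matrix (Fin n) (Fin n) ℂ)).trace.re

section Hilbert

variable (H : Type*) [NormedAddCommGroup H] [InnerProductSpace ℂ H] [CompleteSpace H]

/-- The index set of some fixed orthonormal basis of the Hilbert space `H`. -/
def basisIndex : Set H := Classical.choose (exists_hilbertBasis ℂ H)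

/-- Some fixed orthonormal basis of the Hilbert space `H`. -/
def fixedBasis : HilbertBasis (basisIndex H) ℂ H :=
  Classical.choose (Classical.choose_spec (exists_hilbertBasis ℂ H))

variable {H}

/-- `T` is a trace-class operator: `tr |T| < ∞`, where `|T| = √(T† T)`. -/
def IsTraceClass (T : H →L[ℂ] H) : Prop :=
  Summable fun i => (⟪fixedBasis H i, CFC.abs T (fixedBasis H i)⟫_ℂ).re

/-- The trace of an operator (meaningful if it is trace-class, and then independent of the choice of
orthonormal basis). -/
def opTrace (T : H →L[ℂ] H) : ℂ :=
  ∑' i, ⟪fixedBasis H i, T (fixedBasis H i)⟫_ℂ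

variable (H)

/-- The real vector space of self-adjoint trace-class operators on `H`. (The self-adjoint
trace-class operators are closed under real linear combinations; taking the span of this set adds no
element and only makes it a bundled subspace.) -/
def traceClassSelfAdjoint : Submodule ℝ (selfAdjoint (H →L[ℂ] H)) :=
  Submodule.span ℝ {T | IsTraceClass (T : H →L[ℂ] H)}

/-- The quantum system with Hilbert space `H`: states are the density operators (the positive
trace-class operators of trace one), in the space of self-adjoint trace-class operators, effects the
operators `E` with `0 ≤ E ≤ 1`, in the space of bounded self-adjoint operators, and
`(ρ, E) = tr (ρ E)`. -/
def hilbertQuantumSystem :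
    ProbSystem (selfAdjoint (H →L[ℂ] H)) (traceClassSelfAdjoint H) where
  states := {ρ | IsTraceClass (ρ : H →L[ℂ] H) ∧ (ρ : H →L[ℂ] H).IsPositive ∧
    opTrace (ρ : H →L[ℂ] H) = 1}
  effects := {E | (E : H →L[ℂ] H).IsPositive ∧ (1 - (E : H →L[ℂ] H)).IsPositive}
  prob ρ E := (opTrace ((ρ : H →L[ℂ] H) ∘L (E : H →L[ℂ] H))).re

end Hilbert

/-! ### Bell functionals -/

/-- A family of quantum measurements (POVMs) on `ℂⁿ`. -/
def IsPOVMFamily {n : ℕ} {X X' : Type*} [Fintype X']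
    (e : X' → X → Matrix (Fin n) (Fin n) ℂ) : Prop :=
  (∀ a x, (e a x).PosSemidef) ∧ ∀ x, ∑ a, e a x = 1

/-- Quantum behaviours: `P(a, b | x, y) = tr (ρ (e_{a|x} ⊗ f_{b|y}))` for a density matrix `ρ` on the
tensor product of two finite-dimensional Hilbert spaces and local measurements `e`, `f`. -/
def IsQuantumBehaviour {X Y X' Y' : Type*} [Fintype X'] [Fintype Y']
    (P : X' → Y' → X → Y → ℝ) : Prop :=
  ∃ (m n : ℕ) (ρ : Matrix (Fin m × Fin n) (Fin m × Fin n) ℂ)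
    (e : X' → X → Matrix (Fin m) (Fin m) ℂ) (f : Y' → Y → Matrix (Fin n) (Fin n) ℂ),
    ρ.PosSemidef ∧ ρ.trace = 1 ∧ IsPOVMFamily e ∧ IsPOVMFamily f ∧
    ∀ a b x y, (P a b x y : ℂ) = (ρ * (e a x ⊗ₖ f b y)).trace

section Bell

variable {X Y X' Y' : Type*} [Fintype X] [Fintype Y] [Fintype X'] [Fintype Y']

/-- The value `B[P]` on the table `P` of the Bell functional `B` with coefficients `β`. -/
def bellValue (β P : X' → Y' → X → Y → ℝ) : ℝ :=
  ∑ a, ∑ b, ∑ x, ∑ y, β a b x y * P a b x y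

/-- The number `|B|`, the sum of the absolute values of the coefficients of `B`. -/
def bellNorm (β : X' → Y' → X → Y → ℝ) : ℝ :=
  ∑ a, ∑ b, ∑ x, ∑ y, |β a b x y|

/-- The maximum of a Bell functional over all behaviours on a pair of GPTs. -/
def bellMax {A B : Type*} [NormedAddCommGroup A] [NormedSpace ℝ A] [FiniteDimensional ℝ A]
    [NormedAddCommGroup B] [NormedSpace ℝ B] [FiniteDimensional ℝ B] (G : GPT A) (K : GPT B)
    (β : X' → Y' → X → Y → ℝ) : ℝ :=
  sSup {r | ∃ P : X' → Y' → X → Y → ℝ, IsBehaviour G K P ∧ r = bellValue β P}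

/-- The maximal quantum value of a Bell functional. -/
def bellQuantum (β : X' → Y' → X → Y → ℝ) : ℝ :=
  sSup {r | ∃ P : X' → Y' → X → Y → ℝ, IsQuantumBehaviour P ∧ r = bellValue β P}

end Bell

end GPTTheory

end

/-! Decompose a bipartite state as `ω = ∑ c i • φ i ⊗ ψ i` with product states and apply `Ψ ⊗ Ψ`.
The resulting Hermitian operator `W` need not be positive, but it is nonnegative on products `D ⊗ N`
of positive operators: `φ ↦ tr (Ψ φ * D)` is evaluation at a vector of `A` that is nonnegative on
all states, and `ω` is nonnegative on pairs of such vectors.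

This weak positivity already forces local measurements on `W` to give quantum behaviours. A
measurement on the second factor prepares, for every setting, an ensemble of positive operators with
the same sum on the first factor, and all these ensembles can be steered from one purification of
that sum (`isQuantumBehaviour_of_ensembles`).

Replacing both factors of a product `φ i (e) * ψ i (f)` costs at most `2 ε`, so each table entry
moves by at most `2 ε ∑ |c i|` (`exists_quantumBehaviour_close`). The infimum of `∑ |c i|` is at
most `1 + 2 R`, where `R` is the self-entangleability. Hence the Bell gap is at most `2 ε |B| (1 + 2
R)`; the constant 4 of the theorem leaves a factor 2 to spare.

For a Hilbert space it suffices to simulate the finitely many states and effects of one behaviour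
and one decomposition, with any error `ε' > ε` (`FinitelySimulable`). Compression to the span of
enough basis vectors does this (`finitelySimulable_of_isEmbedding`), since the truncated traces
converge. -/

noncomputable section

namespace GPTTheory

/-! ### Bipartite states, decompositions into product states, and robustness -/

section States

variable {A B : Type*} [NormedAddCommGroup A] [NormedSpace ℝ A] [FiniteDimensional ℝ A]
  [NormedAddCommGroup B] [NormedSpace ℝ B] [FiniteDimensional ℝ B]

/-- Every linear functional on the dual of a finite-dimensional space is an evaluation. -/
theorem exists_forall_apply_eq (l : StrongDual ℝ A →ₗ[ℝ] ℝ) :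
    ∃ a : A, ∀ φ : StrongDual ℝ A, φ a = l φ := by
  let T : (A →ₗ[ℝ] ℝ) ≃ₗ[ℝ] (A →L[ℝ] ℝ) := LinearMap.toContinuousLinearMap
  refine ⟨(Module.evalEquiv ℝ A).symm (l ∘ₗ T.toLinearMap), fun φ => ?_⟩
  have := Module.apply_evalEquiv_symm_apply ℝ A (φ : A →ₗ[ℝ] ℝ) (l ∘ₗ T.toLinearMap)
  simp only [ContinuousLinearMap.coe_coe, LinearMap.comp_apply] at this
  rw [this]
  congr 1

theorem GPT.effects_subset_extendedEffects (G : GPT A) : G.effects ⊆ G.extendedEffects :=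
  fun e he φ hφ => G.state_apply_mem φ hφ e he

/-- By compactness `φ a` is bounded over the states. Rescaling then extends the positivity of
bipartite states from `Ē_A` to the whole cone dual to the states, which is where positive operators
are pulled back to. -/
theorem GPT.exists_pos_smul_mem_extendedEffects (G : GPT A) {a : A}
    (ha : ∀ φ ∈ G.states, 0 ≤ φ a) : ∃ t : ℝ, 0 < t ∧ t • a ∈ G.extendedEffects := by
  obtain ⟨C, hC⟩ := G.isCompact_states.exists_bound_of_continuousOn
    (f := fun φ : StrongDual ℝ A => φ a) (by fun_prop)
  refine ⟨(|C| + 1)⁻¹, by positivity, fun φ hφ => ?_⟩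
  have h0 := ha φ hφ
  have h1 : φ a ≤ |C| + 1 := by
    have := hC φ hφ
    rw [Real.norm_eq_abs] at this
    linarith [le_abs_self (φ a), le_abs_self C]
  rw [map_smul, smul_eq_mul]
  refine ⟨by positivity, ?_⟩
  rw [inv_mul_le_one₀ (by positivity)]
  exact h1

theorem IsBipartiteState.apply_nonneg {G : GPT A} {K : GPT B} {ω : A →ₗ[ℝ] B →ₗ[ℝ] ℝ}
    (hω : IsBipartiteState G K ω) {a : A} {b : B} (ha : ∀ φ ∈ G.states, 0 ≤ φ a)
    (hb : ∀ φ ∈ K.states, 0 ≤ φ b) : 0 ≤ ω a b := by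
  obtain ⟨s, hs, hsa⟩ := G.exists_pos_smul_mem_extendedEffects ha
  obtain ⟨t, ht, htb⟩ := K.exists_pos_smul_mem_extendedEffects hb
  have := hω.nonneg _ hsa _ htb
  simp only [map_smul, LinearMap.smul_apply, smul_eq_mul] at this
  exact nonneg_of_mul_nonneg_right (nonneg_of_mul_nonneg_right this ht) hs

theorem IsBipartiteState.apply_le_one {G : GPT A} {K : GPT B} {ω : A →ₗ[ℝ] B →ₗ[ℝ] ℝ}
    (hω : IsBipartiteState G K ω) {e : A} {f : B} (he : e ∈ G.effects) (hf : f ∈ K.effects) :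
    |ω e f| ≤ 1 := by
  have mG := G.effects_subset_extendedEffects
  have mK := K.effects_subset_extendedEffects
  have h1 := hω.nonneg _ (mG he) _ (mK hf)
  have h2 := hω.nonneg _ (mG (G.unit_sub_mem e he)) _ (mK hf)
  have h3 := hω.nonneg _ (mG G.unit_mem) _ (mK (K.unit_sub_mem f hf))
  have h4 := hω.normalized
  simp only [map_sub, LinearMap.sub_apply] at h2 h3
  rw [abs_of_nonneg h1]
  linarith

/-- The bound 1 on pairs of effects propagates by bilinearity, because effects span; `C` does not
depend on `ω`. -/
theorem exists_bound_bipartiteState (G : GPT A) (K : GPT B) (a : A) (b : B) :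
    ∃ C : ℝ, ∀ ω, IsBipartiteState G K ω → |ω a b| ≤ C := by
  have ha : a ∈ Submodule.span ℝ G.effects := G.span_effects ▸ Submodule.mem_top
  have hb : b ∈ Submodule.span ℝ K.effects := K.span_effects ▸ Submodule.mem_top
  induction ha using Submodule.span_induction with
  | zero => exact ⟨0, by simp⟩
  | add x y _ _ hx hy =>
    obtain ⟨C, hC⟩ := hx
    obtain ⟨D, hD⟩ := hy
    refine ⟨C + D, fun ω h => ?_⟩
    rw [map_add, LinearMap.add_apply]
    exact (abs_add_le _ _).trans (add_le_add (hC ω h) (hD ω h))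
  | smul t x _ hx =>
    obtain ⟨C, hC⟩ := hx
    refine ⟨|t| * C, fun ω h => ?_⟩
    rw [map_smul, LinearMap.smul_apply, smul_eq_mul, abs_mul]
    exact mul_le_mul_of_nonneg_left (hC ω h) (abs_nonneg _)
  | mem e he =>
    induction hb using Submodule.span_induction with
    | zero => exact ⟨0, by simp⟩
    | add x y _ _ hx hy =>
      obtain ⟨C, hC⟩ := hx
      obtain ⟨D, hD⟩ := hy
      refine ⟨C + D, fun ω h => ?_⟩
      rw [map_add]
      exact (abs_add_le _ _).trans (add_le_add (hC ω h) (hD ω h))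
    | smul t x _ hx =>
      obtain ⟨C, hC⟩ := hx
      refine ⟨|t| * C, fun ω h => ?_⟩
      rw [map_smul, smul_eq_mul, abs_mul]
      exact mul_le_mul_of_nonneg_left (hC ω h) (abs_nonneg _)
    | mem f hf => exact ⟨1, fun ω h => h.apply_le_one he hf⟩

/-- A GPT has a basis of the dual space that consists of states, with a dual basis of the effect
space. -/
theorem GPT.exists_state_basis (G : GPT A) :
    ∃ (n : ℕ) (φ : Fin n → StrongDual ℝ A) (v : Fin n → A), (∀ i, φ i ∈ G.states) ∧
      ∀ a, a = ∑ i, φ i a • v i := by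
  let b := Module.Basis.ofSpan (K := ℝ) (s := G.states) G.span_states.ge
  have : Fintype _ := Module.Basis.fintypeIndexOfRankLtAleph0 b (Module.rank_lt_aleph0 _ _)
  let b' := b.reindex (Fintype.equivFin _)
  have hb : ∀ i, b' i ∈ G.states := fun i =>
    Module.Basis.ofSpan_subset G.span_states.ge ⟨(Fintype.equivFin _).symm i, by simp [b', b]⟩
  choose v hv using fun i => exists_forall_apply_eq (b'.coord i)
  refine ⟨_, b', v, hb, fun a => ?_⟩
  refine (SeparatingDual.eq_iff_forall_dual_eq (R := ℝ)).2 fun φ => ?_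
  have hφ : φ a = (∑ i, b'.repr φ i • b' i) a := by rw [b'.sum_repr φ]
  rw [hφ, map_sum, sum_apply]
  refine Finset.sum_congr rfl fun i _ => ?_
  rw [map_smul, hv, Module.Basis.coord_apply, smul_apply, smul_eq_mul,
    smul_eq_mul, mul_comm]

/-- Expanding `ω` in bases of states gives the coefficients `ω (v i) (w j)`, which are bounded
uniformly in `ω`. So the supremum in `selfEntangleability` is over a bounded set and is not the
default value 0. -/
theorem exists_uniform_decompositionWeight (G : GPT A) (K : GPT B) :
    ∃ C : ℝ, ∀ ω, IsBipartiteState G K ω → ∃ r ∈ decompositionWeights G K ω, r ≤ C := by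
  obtain ⟨m, φ, v, hφ, hv⟩ := G.exists_state_basis
  obtain ⟨n, ψ, w, hψ, hw⟩ := K.exists_state_basis
  choose C hC using fun a b => exists_bound_bipartiteState G K a b
  refine ⟨∑ p : Fin m × Fin n, C (v p.1) (w p.2), fun ω hω => ?_⟩
  let g := (finProdFinEquiv : Fin m × Fin n ≃ Fin (m * n))
  have hdec : ∀ a b, ω a b = ∑ i, ω (v (g.symm i).1) (w (g.symm i).2) *
      (φ (g.symm i).1 a * ψ (g.symm i).2 b) := by
    intro a b
    rw [g.symm.sum_comp fun p : Fin m × Fin n => ω (v p.1) (w p.2) * (φ p.1 a * ψ p.2 b),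
      Fintype.sum_prod_type]
    conv_lhs => rw [hv a, hw b]
    simp only [map_sum, map_smul, LinearMap.sum_apply, LinearMap.smul_apply, smul_eq_mul,
      Finset.mul_sum]
    rw [Finset.sum_comm]
    exact Finset.sum_congr rfl fun i _ => Finset.sum_congr rfl fun j _ => by ring
  refine ⟨_, ⟨m * n, fun i => ω (v (g.symm i).1) (w (g.symm i).2), fun i => φ (g.symm i).1,
    fun i => ψ (g.symm i).2, fun i => hφ _, fun i => hψ _, hdec, ?_, rfl⟩, ?_⟩
  -- Evaluation at the two units shows that the coefficients sum to 1.
  · rw [← hω.normalized, hdec]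
    simp [G.state_apply_unit _ (hφ _), K.state_apply_unit _ (hψ _)]
  · rw [g.symm.sum_comp fun p : Fin m × Fin n => |ω (v p.1) (w p.2)|]
    exact Finset.sum_le_sum fun p _ => hC _ _ ω hω

theorem one_le_of_mem_decompositionWeights {G : GPT A} {K : GPT B} {ω : A →ₗ[ℝ] B →ₗ[ℝ] ℝ} {r : ℝ}
    (hr : r ∈ decompositionWeights G K ω) : 1 ≤ r := by
  obtain ⟨n, c, φ, ψ, -, -, -, hc, rfl⟩ := hr
  rw [← hc]
  exact Finset.sum_le_sum fun i _ => le_abs_self _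

theorem bddBelow_decompositionWeights (G : GPT A) (K : GPT B) (ω : A →ₗ[ℝ] B →ₗ[ℝ] ℝ) :
    BddBelow (decompositionWeights G K ω) :=
  ⟨1, fun _ => one_le_of_mem_decompositionWeights⟩

theorem robustness_le_selfEntangleability (G : GPT A) {ω : A →ₗ[ℝ] A →ₗ[ℝ] ℝ}
    (hω : IsBipartiteState G G ω) : robustness G G ω ≤ selfEntangleability G := by
  obtain ⟨C, hC⟩ := exists_uniform_decompositionWeight G G
  refine le_csSup ⟨1 / 2 * C - 1 / 2, ?_⟩ ⟨ω, hω, rfl⟩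
  rintro _ ⟨τ, hτ, rfl⟩
  obtain ⟨r, hr, hrC⟩ := hC τ hτ
  have := csInf_le (bddBelow_decompositionWeights G G τ) hr
  unfold robustness
  linarith

theorem sInf_decompositionWeights_le (G : GPT A) {ω : A →ₗ[ℝ] A →ₗ[ℝ] ℝ}
    (hω : IsBipartiteState G G ω) :
    sInf (decompositionWeights G G ω) ≤ 1 + 2 * selfEntangleability G := by
  have := robustness_le_selfEntangleability G hω
  unfold robustness at this
  linarith

theorem decompositionWeights_nonempty {G : GPT A} {K : GPT B} {ω : A →ₗ[ℝ] B →ₗ[ℝ] ℝ}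
    (hω : IsBipartiteState G K ω) : (decompositionWeights G K ω).Nonempty := by
  obtain ⟨C, hC⟩ := exists_uniform_decompositionWeight G K
  obtain ⟨r, hr, -⟩ := hC ω hω
  exact ⟨r, hr⟩

theorem one_le_one_add_two_mul_selfEntangleability (G : GPT A) {ω : A →ₗ[ℝ] A →ₗ[ℝ] ℝ}
    (hω : IsBipartiteState G G ω) : 1 ≤ 1 + 2 * selfEntangleability G :=
  (le_csInf (decompositionWeights_nonempty hω) fun _ => one_le_of_mem_decompositionWeights).trans
    (sInf_decompositionWeights_le G hω)

theorem exists_decompositionWeight_lt (G : GPT A) {ω : A →ₗ[ℝ] A →ₗ[ℝ] ℝ}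
    (hω : IsBipartiteState G G ω) {C : ℝ} (hC : 1 + 2 * selfEntangleability G < C) :
    ∃ r ∈ decompositionWeights G G ω, r < C :=
  exists_lt_of_csInf_lt (decompositionWeights_nonempty hω)
    ((sInf_decompositionWeights_le G hω).trans_lt hC)

end States

/-! ### Positive matrices, purifications and steering -/

section Matrices

variable {n : ℕ}

theorem trace_mul_nonneg {k : Type*} [Fintype k] {M N : Matrix k k ℂ} (hM : M.PosSemidef)
    (hN : N.PosSemidef) : 0 ≤ (M * N).trace := by
  classical
  open scoped MatrixOrder in
  obtain ⟨R, rfl⟩ := CStarAlgebra.nonneg_iff_eq_star_mul_self.mp hN.nonneg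
  rw [Matrix.star_eq_conjTranspose, ← Matrix.mul_assoc, Matrix.trace_mul_comm, ← Matrix.mul_assoc]
  exact (hM.mul_mul_conjTranspose_same R).trace_nonneg

theorem posSemidef_of_forall_trace_mul_nonneg {M : Matrix (Fin n) (Fin n) ℂ}
    (hM : M.IsHermitian) (h : ∀ N : Matrix (Fin n) (Fin n) ℂ, N.PosSemidef → 0 ≤ (M * N).trace) :
    M.PosSemidef := by
  refine .of_dotProduct_mulVec_nonneg hM fun v => ?_
  have := h _ (Matrix.posSemidef_vecMulVec_self_star v)
  rwa [Matrix.mul_vecMulVec, Matrix.trace_vecMulVec, dotProduct_comm] at this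

theorem IsPOVMFamily.one_sub_posSemidef {X X' : Type*} [Fintype X']
    {e : X' → X → Matrix (Fin n) (Fin n) ℂ} (he : IsPOVMFamily e) (a : X') (x : X) :
    (1 - e a x).PosSemidef := by
  classical
  rw [← he.2 x, ← Finset.add_sum_erase _ _ (Finset.mem_univ a), add_sub_cancel_left]
  exact Matrix.posSemidef_sum _ fun i _ => he.1 i x

theorem IsQuantumBehaviour.mem_Icc {X Y X' Y' : Type*} [Fintype X'] [Fintype Y']
    {P : X' → Y' → X → Y → ℝ} (hP : IsQuantumBehaviour P) (a : X') (b : Y') (x : X) (y : Y) :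
    P a b x y ∈ Set.Icc (0 : ℝ) 1 := by
  obtain ⟨m, n, ρ, e, f, hρ, htr, he, hf, h⟩ := hP
  have h0 := trace_mul_nonneg hρ ((he.1 a x).kronecker (hf.1 b y))
  have h1 : (1 - e a x ⊗ₖ f b y).PosSemidef := by
    have : 1 - e a x ⊗ₖ f b y = (1 - e a x) ⊗ₖ 1 + e a x ⊗ₖ (1 - f b y) := by
      rw [← Matrix.one_kronecker_one]
      ext i j
      simp only [Matrix.sub_apply, Matrix.add_apply, Matrix.kroneckerMap_apply]
      ring
    rw [this]
    exact ((he.one_sub_posSemidef a x).kronecker .one).add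
      ((he.1 a x).kronecker (hf.one_sub_posSemidef b y))
  have h1 := trace_mul_nonneg hρ h1
  rw [Matrix.mul_sub, Matrix.mul_one, Matrix.trace_sub, htr, ← h] at h1
  rw [← h] at h0
  exact ⟨by exact_mod_cast h0, by simpa using (by exact_mod_cast h1 : (0 : ℝ) ≤ 1 - P a b x y)⟩

/-- A square root `S` of a positive semidefinite matrix, and the pseudo-inverse `T` of `S`. -/
theorem exists_sqrt_pseudoInverse {σ : Matrix (Fin n) (Fin n) ℂ} (hσ : σ.PosSemidef) :
    ∃ S T : Matrix (Fin n) (Fin n) ℂ, S.IsHermitian ∧ T.IsHermitian ∧ S * S = σ ∧ S * T = T * S ∧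
      S * T * S = S := by
  obtain ⟨U, hU, d, hd, hσd⟩ : ∃ U : Matrix (Fin n) (Fin n) ℂ, U.conjTranspose * U = 1 ∧
      ∃ d : Fin n → ℝ, (∀ i, 0 ≤ d i) ∧
        σ = U * Matrix.diagonal (fun i => (d i : ℂ)) * U.conjTranspose := by
    refine ⟨hσ.1.eigenvectorUnitary, Unitary.coe_star_mul_self hσ.1.eigenvectorUnitary,
      hσ.1.eigenvalues, hσ.eigenvalues_nonneg, ?_⟩
    conv_lhs => rw [hσ.1.spectral_theorem, Unitary.conjStarAlgAut_apply]
    rfl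
  have hD : ∀ f : Fin n → ℝ,
      (U * Matrix.diagonal (fun i => (f i : ℂ)) * U.conjTranspose).IsHermitian := fun f =>
    Matrix.isHermitian_mul_mul_conjTranspose U
      (Matrix.isHermitian_diagonal_of_self_adjoint _ (by ext i; simp))
  have hmul : ∀ f g : Fin n → ℝ, U * Matrix.diagonal (fun i => (f i : ℂ)) * U.conjTranspose *
      (U * Matrix.diagonal (fun i => (g i : ℂ)) * U.conjTranspose) =
      U * Matrix.diagonal (fun i => ((f i * g i : ℝ) : ℂ)) * U.conjTranspose := fun f g => by
    calc _ = U * Matrix.diagonal (fun i => (f i : ℂ)) * (U.conjTranspose * U) *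
          Matrix.diagonal (fun i => (g i : ℂ)) * U.conjTranspose := by
          simp only [Matrix.mul_assoc]
      _ = _ := by
          rw [hU, Matrix.mul_one, Matrix.mul_assoc U, Matrix.diagonal_mul_diagonal]
          simp only [Complex.ofReal_mul]
  -- The convention `0⁻¹ = 0` makes the second matrix a pseudo-inverse when `σ` is singular.
  refine ⟨_, _, hD fun i => √(d i), hD fun i => (√(d i))⁻¹, ?_, ?_, ?_⟩
  · rw [hmul, hσd]
    simp only [Real.mul_self_sqrt (hd _)]
  · rw [hmul, hmul]
    simp only [mul_comm]
  · rw [hmul, hmul]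
    simp only [mul_inv_mul_cancel]

/-- The entries of `S`, read as a vector, purify `S * Sᴴ`; the transpose on `F` comes from this
vectorization. -/
theorem trace_vecMulVec_mul_kronecker (S E F : Matrix (Fin n) (Fin n) ℂ) :
    (Matrix.vecMulVec (fun p : Fin n × Fin n => S p.1 p.2) (star fun p : Fin n × Fin n => S p.1 p.2) *
      (E ⊗ₖ F)).trace = (E * S * F.transpose * S.conjTranspose).trace := by
  rw [Matrix.vecMulVec_mul, Matrix.trace_vecMulVec, dotProduct_comm, ← Matrix.dotProduct_mulVec]
  simp only [dotProduct, Matrix.mulVec, Matrix.trace, Matrix.diag, Matrix.mul_apply,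
    Fintype.sum_prod_type, Finset.sum_mul, Finset.mul_sum, Matrix.kroneckerMap_apply,
    Matrix.transpose_apply, Matrix.conjTranspose_apply, Pi.star_apply]
  refine Finset.sum_congr rfl fun i _ => Finset.sum_congr rfl fun j _ => ?_
  rw [Finset.sum_comm]
  exact Finset.sum_congr rfl fun k _ => Finset.sum_congr rfl fun l _ => by ring

/-- With `M = Rᴴ R` the hypothesis reads `(R Q)ᴴ (R Q) = 0`, so `R Q = 0`. -/
theorem mul_eq_zero_of_conjugate_eq_zero {M Q : Matrix (Fin n) (Fin n) ℂ} (hM : M.PosSemidef)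
    (h : Q.conjTranspose * M * Q = 0) : M * Q = 0 := by
  open scoped MatrixOrder in
  obtain ⟨R, rfl⟩ := CStarAlgebra.nonneg_iff_eq_star_mul_self.mp hM.nonneg
  have : (R * Q).conjTranspose * (R * Q) = 0 := by
    rw [← h, Matrix.conjTranspose_mul, Matrix.star_eq_conjTranspose]
    simp only [Matrix.mul_assoc]
  rw [Matrix.mul_assoc, Matrix.conjTranspose_mul_self_eq_zero.1 this, Matrix.mul_zero]

/-- Steering ensembles are realized by quantum measurements on a purification: if one party
prepares, for each setting `y`, an ensemble `(M b y)_b` of subnormalized states with average `σ` for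
the other party, then the resulting behaviour is quantum. -/
theorem isQuantumBehaviour_of_ensembles {X Y X' Y' : Type*} [Fintype X'] [Fintype Y'] [Nonempty Y']
    {σ : Matrix (Fin n) (Fin n) ℂ} (hσ : σ.PosSemidef) (htr : σ.trace = 1)
    {e : X' → X → Matrix (Fin n) (Fin n) ℂ} (he : IsPOVMFamily e)
    {M : Y' → Y → Matrix (Fin n) (Fin n) ℂ} (hM : ∀ b y, (M b y).PosSemidef)
    (hsum : ∀ y, ∑ b, M b y = σ) {P : X' → Y' → X → Y → ℝ}
    (hP : ∀ a b x y, (P a b x y : ℂ) = (e a x * M b y).trace) : IsQuantumBehaviour P := by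
  classical
  obtain ⟨S, T, hS, hT, hSS, hcomm, hSTS⟩ := exists_sqrt_pseudoInverse hσ
  obtain ⟨b₀⟩ := ‹Nonempty Y'›
  -- `S * T` is the projection onto the support of `σ`, and `Q` the projection onto its kernel.
  let Q := 1 - S * T
  have hQ : Q.conjTranspose = Q := by
    simp [Q, hS.eq, hT.eq, hcomm]
  have hSQ : S * Q = 0 := by
    simp only [Q, Matrix.mul_sub, Matrix.mul_one]
    rw [hcomm, ← Matrix.mul_assoc, hSTS, sub_self]
  have hQS : Q * S = 0 := by
    simp only [Q, Matrix.sub_mul, Matrix.one_mul]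
    rw [hSTS, sub_self]
  have hTST : S * T * (S * T) = S * T := by
    rw [← Matrix.mul_assoc, hSTS]
  have hQQ : Q * Q = Q := by
    simp only [Q, Matrix.mul_sub, Matrix.sub_mul, Matrix.one_mul, Matrix.mul_one, hTST]
    abel
  -- Each `M b y` is one of several positive summands of `σ`, so it vanishes on the kernel of `σ`.
  have hMQ : ∀ b y, M b y * Q = 0 := by
    intro b y
    refine mul_eq_zero_of_conjugate_eq_zero (hM b y) ?_
    have hs : ∑ b, Q.conjTranspose * M b y * Q = 0 := by
      rw [← Matrix.sum_mul, ← Matrix.mul_sum, hsum, ← hSS, Matrix.mul_assoc, Matrix.mul_assoc,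
        hSQ, Matrix.mul_zero, Matrix.mul_zero]
    open scoped MatrixOrder in
    exact (Finset.sum_eq_zero_iff_of_nonneg fun b _ =>
      ((hM b y).conjTranspose_mul_mul_same Q).nonneg).1 hs b (Finset.mem_univ b)
  have hMST : ∀ b y, M b y * (S * T) = M b y := by
    intro b y
    have := hMQ b y
    simp only [Q, Matrix.mul_sub, Matrix.mul_one] at this
    exact (sub_eq_zero.1 this).symm
  have hSTM : ∀ b y, (S * T) * M b y = M b y := by
    intro b y
    have := congrArg Matrix.conjTranspose (hMST b y)
    rw [Matrix.conjTranspose_mul, Matrix.conjTranspose_mul, hS.eq, hT.eq, (hM b y).1.eq] at this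
    rw [hcomm]
    exact this
  -- The steering measurement `σ^(-1/2) M σ^(-1/2)` sums only to the support projection; `Q`, given
  -- to one outcome, completes it and is invisible to `S`.
  let F : Y' → Y → Matrix (Fin n) (Fin n) ℂ := fun b y =>
    T * M b y * T + if b = b₀ then Q else 0
  have hF : ∀ b y, (F b y).PosSemidef := by
    intro b y
    have h1 := (hM b y).conjTranspose_mul_mul_same T
    rw [hT.eq] at h1
    refine h1.add ?_
    split_ifs
    · have := Matrix.posSemidef_conjTranspose_mul_self Q
      rwa [hQ, hQQ] at this
    · exact .zero
  have hSFS : ∀ b y, S * F b y * S = M b y := by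
    intro b y
    have : S * (if b = b₀ then Q else 0) * S = 0 := by split_ifs <;> simp [hSQ]
    simp only [F, Matrix.mul_add, Matrix.add_mul, this, add_zero]
    calc S * (T * M b y * T) * S = (S * T) * M b y * (T * S) := by simp only [Matrix.mul_assoc]
      _ = M b y := by rw [← hcomm, hSTM, hMST]
  refine ⟨n, n, Matrix.vecMulVec (fun p : Fin n × Fin n => S p.1 p.2) (star fun p : Fin n × Fin n => S p.1 p.2),
    e, fun b y => (F b y).transpose, Matrix.posSemidef_vecMulVec_self_star _, ?_, he,
    ⟨fun b y => (hF b y).transpose, fun y => ?_⟩, fun a b x y => ?_⟩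
  · have := trace_vecMulVec_mul_kronecker S 1 1
    rw [Matrix.one_kronecker_one, Matrix.mul_one, Matrix.transpose_one, Matrix.mul_one,
      Matrix.one_mul, hS.eq, hSS, htr] at this
    exact this
  · rw [← Matrix.transpose_sum]
    simp only [F, Finset.sum_add_distrib, Finset.sum_ite_eq', Finset.mem_univ, if_true]
    rw [← Matrix.sum_mul, ← Matrix.mul_sum, hsum, ← hSS]
    have : T * (S * S) * T = S * T := by
      rw [← Matrix.mul_assoc, ← hcomm, hSTS]
    rw [this]
    simp [Q]
  · rw [hP, trace_vecMulVec_mul_kronecker, Matrix.transpose_transpose, hS.eq]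
    conv_lhs => rw [← hSFS b y]
    simp only [Matrix.mul_assoc]

end Matrices

/-! ### From an approximate embedding to a nearby quantum behaviour -/

section Simulation

theorem trace_mul_eq_ofReal {k : Type*} [Fintype k] {M N : Matrix k k ℂ} (hM : M.IsHermitian)
    (hN : N.IsHermitian) : (M * N).trace = ((M * N).trace.re : ℂ) := by
  refine (Complex.conj_eq_iff_re.1 ?_).symm
  change star (M * N).trace = _
  rw [← Matrix.trace_conjTranspose, Matrix.conjTranspose_mul, hM.eq, hN.eq, Matrix.trace_mul_comm]

theorem trace_mul_re_mem_Icc {k : Type*} [Fintype k] [DecidableEq k] {ρ E : Matrix k k ℂ}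
    (hρ : ρ.PosSemidef) (htr : ρ.trace = 1) (hE : E.PosSemidef) (hE1 : (1 - E).PosSemidef) :
    (ρ * E).trace.re ∈ Set.Icc (0 : ℝ) 1 := by
  have h0 := Complex.re_le_re (trace_mul_nonneg hρ hE)
  have h1 := Complex.re_le_re (trace_mul_nonneg hρ hE1)
  rw [Matrix.mul_sub, Matrix.mul_one, Matrix.trace_sub, htr] at h1
  simp only [Complex.zero_re, Complex.sub_re, Complex.one_re] at h0 h1
  exact ⟨h0, by linarith⟩

variable {A : Type*} [NormedAddCommGroup A] [NormedSpace ℝ A] [FiniteDimensional ℝ A]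
  {G : GPT A} {n : ℕ}

/-- The image of a measurement under an effect-preserving map can be completed to a measurement
that is equally close to the original one. -/
theorem exists_POVMFamily_close {X X' : Type*} [Fintype X'] [Nonempty X']
    {Φ : A →ₗ[ℝ] selfAdjoint (Matrix (Fin n) (Fin n) ℂ)}
    (hΦ : ∀ e ∈ G.effects, Φ e ∈ (quantumSystem n).effects) {e : X' → X → A}
    (he : G.IsMeasurementFamily e) :
    ∃ E : X' → X → Matrix (Fin n) (Fin n) ℂ, IsPOVMFamily E ∧
      ∀ (ρ : Matrix (Fin n) (Fin n) ℂ) (t ε : ℝ) (a : X') (x : X), ρ.trace = 1 →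
        |t - (ρ * Φ (e a x)).trace.re| ≤ ε → |1 - t - (ρ * Φ (G.unit - e a x)).trace.re| ≤ ε →
        |t - (ρ * E a x).trace.re| ≤ ε := by
  classical
  obtain ⟨a₀⟩ := ‹Nonempty X'›
  -- `Φ` need not preserve the unit, so the defect goes to the outcome `a₀`. Its effect becomes `1 -
  -- Φ (u - e)`, whose error is that of the complementary effect; no extra error arises.
  refine ⟨fun a x => Φ (e a x) + if a = a₀ then 1 - (Φ G.unit : Matrix (Fin n) (Fin n) ℂ) else 0,
    ⟨fun a x => ?_, fun x => ?_⟩, fun ρ t ε a x hρ h1 h2 => ?_⟩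
  · refine (hΦ _ (he.1 a x)).1.add ?_
    split_ifs
    · exact (hΦ _ G.unit_mem).2
    · exact .zero
  · have : ∑ a, (Φ (e a x) : Matrix (Fin n) (Fin n) ℂ) = Φ G.unit := by
      rw [← he.2 x, map_sum]
      simp
    simp [Finset.sum_add_distrib, this]
  · dsimp only
    split_ifs with ha
    · have : (Φ (e a x) : Matrix (Fin n) (Fin n) ℂ) + (1 - Φ G.unit) = 1 - Φ (G.unit - e a x) := by
        rw [map_sub, AddSubgroupClass.coe_sub]
        abel
      rw [this, Matrix.mul_sub, Matrix.mul_one, Matrix.trace_sub, hρ, Complex.sub_re,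
        Complex.one_re, ← abs_neg]
      convert h2 using 2
      ring
    · rwa [add_zero]

theorem abs_mul_sub_mul_le {p q p' q' ε : ℝ} (hp : p ∈ Set.Icc (0 : ℝ) 1)
    (hq' : q' ∈ Set.Icc (0 : ℝ) 1) (h : |p - p'| ≤ ε) (h' : |q - q'| ≤ ε) :
    |p * q - p' * q'| ≤ 2 * ε := by
  have : p * q - p' * q' = p * (q - q') + (p - p') * q' := by ring
  rw [this]
  refine (abs_add_le _ _).trans ?_
  rw [abs_mul, abs_mul, abs_of_nonneg hp.1, abs_of_nonneg hq'.1]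
  nlinarith [hp.1, hp.2, hq'.1, hq'.2, abs_nonneg (p - p'), abs_nonneg (q - q')]

theorem exists_dual_effect (Ψ : StrongDual ℝ A →ₗ[ℝ] selfAdjoint (Matrix (Fin n) (Fin n) ℂ))
    (E : Matrix (Fin n) (Fin n) ℂ) :
    ∃ a : A, ∀ φ, φ a = ((Ψ φ : Matrix (Fin n) (Fin n) ℂ) * E).trace.re :=
  exists_forall_apply_eq
    { toFun := fun φ => ((Ψ φ : Matrix (Fin n) (Fin n) ℂ) * E).trace.re
      map_add' := fun φ ψ => by simp [Matrix.add_mul]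
      map_smul' := fun r φ => by simp }

/-- A behaviour is close to a quantum behaviour if the local states and measurements that occur in
it are mapped to a quantum system in such a way that the probabilities change little. -/
theorem exists_quantumBehaviour_close
    {Φ : A →ₗ[ℝ] selfAdjoint (Matrix (Fin n) (Fin n) ℂ)}
    {Ψ : StrongDual ℝ A →ₗ[ℝ] selfAdjoint (Matrix (Fin n) (Fin n) ℂ)}
    (hΦ : ∀ e ∈ G.effects, Φ e ∈ (quantumSystem n).effects)
    (hΨ : ∀ φ ∈ G.states, Ψ φ ∈ (quantumSystem n).states)
    {ω : A →ₗ[ℝ] A →ₗ[ℝ] ℝ} (hω : IsBipartiteState G G ω)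
    {k : ℕ} {c : Fin k → ℝ} {φ ψ : Fin k → StrongDual ℝ A} (hφ : ∀ i, φ i ∈ G.states)
    (hψ : ∀ i, ψ i ∈ G.states) (hdec : ∀ a b, ω a b = ∑ i, c i * (φ i a * ψ i b))
    (hc : ∑ i, c i = 1)
    {X Y X' Y' : Type*} [Fintype X'] [Fintype Y'] [Nonempty X'] [Nonempty Y']
    {e : X' → X → A} {f : Y' → Y → A} (he : G.IsMeasurementFamily e)
    (hf : G.IsMeasurementFamily f) {ε : ℝ}
    (h1 : ∀ i a x, |φ i (e a x) - (quantumSystem n).prob (Ψ (φ i)) (Φ (e a x))| ≤ ε)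
    (h1' : ∀ i a x, |φ i (G.unit - e a x) -
      (quantumSystem n).prob (Ψ (φ i)) (Φ (G.unit - e a x))| ≤ ε)
    (h2 : ∀ i b y, |ψ i (f b y) - (quantumSystem n).prob (Ψ (ψ i)) (Φ (f b y))| ≤ ε)
    (h2' : ∀ i b y, |ψ i (G.unit - f b y) -
      (quantumSystem n).prob (Ψ (ψ i)) (Φ (G.unit - f b y))| ≤ ε) :
    ∃ Q : X' → Y' → X → Y → ℝ, IsQuantumBehaviour Q ∧
      ∀ a b x y, |ω (e a x) (f b y) - Q a b x y| ≤ 2 * ε * ∑ i, |c i| := by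
  obtain ⟨E, hE, hEc⟩ := exists_POVMFamily_close hΦ he
  obtain ⟨F, hF, hFc⟩ := exists_POVMFamily_close hΦ hf
  let pr (φ : StrongDual ℝ A) (N : Matrix (Fin n) (Fin n) ℂ) : ℝ :=
    ((Ψ φ : Matrix (Fin n) (Fin n) ℂ) * N).trace.re
  -- The unnormalized state of the first factor after the outcome `N` on the second: the partial
  -- trace of `(Ψ ⊗ Ψ) ω` against `N`.
  let M (N : Matrix (Fin n) (Fin n) ℂ) : Matrix (Fin n) (Fin n) ℂ :=
    ∑ i, (c i * pr (ψ i) N) • (Ψ (φ i) : Matrix (Fin n) (Fin n) ℂ)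
  have hMH : ∀ N, (M N).IsHermitian := fun N => by
    have : IsSelfAdjoint (M N) := isSelfAdjoint_sum _ fun i _ =>
      (IsSelfAdjoint.all (c i * pr (ψ i) N)).smul (Ψ (φ i)).2
    exact this
  have hMtr : ∀ N D, (M N * D).trace.re = ∑ i, c i * (pr (φ i) D * pr (ψ i) N) := by
    intro N D
    simp only [M, Matrix.sum_mul, Matrix.trace_sum, Complex.re_sum, Matrix.smul_mul,
      Matrix.trace_smul, Complex.real_smul, Complex.re_ofReal_mul]
    exact Finset.sum_congr rfl fun i _ => by simp only [pr]; ring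
  have hpr : ∀ φ ∈ G.states, ∀ N : Matrix (Fin n) (Fin n) ℂ, N.PosSemidef → 0 ≤ pr φ N :=
    fun φ hφ N hN => (Complex.re_le_re (trace_mul_nonneg (hΨ φ hφ).1 hN) :)
  -- The only use of the positivity of `ω`: testing `M N` against a positive `D` gives `ω a b`, with
  -- `a` and `b` the pullbacks of `D` and `N` along `Ψ`.
  have hM : ∀ N : Matrix (Fin n) (Fin n) ℂ, N.PosSemidef → (M N).PosSemidef := by
    intro N hN
    refine posSemidef_of_forall_trace_mul_nonneg (hMH N) fun D hD => ?_
    rw [trace_mul_eq_ofReal (hMH N) hD.1, hMtr]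
    obtain ⟨a, ha⟩ := exists_dual_effect Ψ D
    obtain ⟨b, hb⟩ := exists_dual_effect Ψ N
    have := hω.apply_nonneg (a := a) (b := b) (fun χ hχ => by rw [ha]; exact hpr χ hχ D hD)
      (fun χ hχ => by rw [hb]; exact hpr χ hχ N hN)
    rw [hdec] at this
    simp only [ha, hb] at this
    exact_mod_cast this
  have hst : ∀ χ ∈ G.states, (Ψ χ : Matrix (Fin n) (Fin n) ℂ).trace = 1 := fun χ hχ => (hΨ χ hχ).2
  have hpr1 : ∀ χ ∈ G.states, pr χ 1 = 1 := fun χ hχ => by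
    simp only [pr, Matrix.mul_one, hst χ hχ, Complex.one_re]
  refine ⟨fun a b x y => (E a x * M (F b y)).trace.re, ?_, fun a b x y => ?_⟩
  · refine isQuantumBehaviour_of_ensembles (hM 1 .one) ?_ hE (M := fun b y => M (F b y))
      (fun b y => hM _ (hF.1 b y)) (fun y => ?_) (fun a b x y => ?_)
    · have h3 := hMtr 1 1
      have h4 := trace_mul_eq_ofReal (hMH 1) (Matrix.isHermitian_one (n := Fin n) (α := ℂ))
      rw [h3] at h4
      simp only [hpr1 _ (hφ _), hpr1 _ (hψ _), mul_one, hc] at h4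
      simpa using h4
    · simp only [M]
      rw [Finset.sum_comm, ← hF.2 y]
      refine Finset.sum_congr rfl fun i _ => ?_
      rw [← Finset.sum_smul, ← Finset.mul_sum]
      simp only [pr, Matrix.mul_sum, Matrix.trace_sum, Complex.re_sum]
    · exact (trace_mul_eq_ofReal (hE.1 a x).1 (hMH _)).symm
  · dsimp only
    rw [Matrix.trace_mul_comm, hMtr, hdec, ← Finset.sum_sub_distrib, Finset.mul_sum]
    refine (Finset.abs_sum_le_sum_abs _ _).trans (Finset.sum_le_sum fun i _ => ?_)
    rw [← mul_sub, abs_mul, mul_comm]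
    refine mul_le_mul_of_nonneg_right ?_ (abs_nonneg _)
    have hu := G.state_apply_unit _ (hφ i)
    have hv := G.state_apply_unit _ (hψ i)
    refine abs_mul_sub_mul_le (G.state_apply_mem _ (hφ i) _ (he.1 a x))
      (trace_mul_re_mem_Icc (hΨ _ (hψ i)).1 (hst _ (hψ i)) (hF.1 b y) (hF.one_sub_posSemidef b y))
      ?_ ?_
    · have h3 := h1' i a x
      rw [map_sub, hu] at h3
      exact hEc _ _ _ a x (hst _ (hφ i)) (h1 i a x) h3
    · have h3 := h2' i b y
      rw [map_sub, hv] at h3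
      exact hFc _ _ _ b y (hst _ (hψ i)) (h2 i b y) h3

end Simulation

/-! ### Continuity and boundedness of Bell functionals -/

section BellBounds

variable {X Y X' Y' : Type*} [Fintype X] [Fintype Y] [Fintype X'] [Fintype Y']

theorem bellValue_sub_le (β P Q : X' → Y' → X → Y → ℝ) {δ : ℝ}
    (h : ∀ a b x y, |P a b x y - Q a b x y| ≤ δ) :
    bellValue β P - bellValue β Q ≤ bellNorm β * δ := by
  simp only [bellValue, bellNorm, ← Finset.sum_sub_distrib, Finset.sum_mul, ← mul_sub]
  refine Finset.sum_le_sum fun a _ => Finset.sum_le_sum fun b _ => Finset.sum_le_sum fun x _ =>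
    Finset.sum_le_sum fun y _ => (le_abs_self _).trans ?_
  rw [abs_mul]
  exact mul_le_mul_of_nonneg_left (h a b x y) (abs_nonneg _)

theorem bellNorm_nonneg (β : X' → Y' → X → Y → ℝ) : 0 ≤ bellNorm β := by
  unfold bellNorm
  positivity

theorem bellValue_le_bellQuantum (β : X' → Y' → X → Y → ℝ) {P : X' → Y' → X → Y → ℝ}
    (hP : IsQuantumBehaviour P) : bellValue β P ≤ bellQuantum β := by
  refine le_csSup ⟨bellNorm β, ?_⟩ ⟨P, hP, rfl⟩
  rintro _ ⟨Q, hQ, rfl⟩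
  have := bellValue_sub_le β Q 0 (δ := 1) fun a b x y => by
    have := hQ.mem_Icc a b x y
    rw [abs_le]
    constructor <;> simp <;> linarith [this.1, this.2]
  simpa [bellValue] using this

end BellBounds

/-! ### Finite simulability bounds the Bell violation -/

section Approximation

variable {A : Type*} [NormedAddCommGroup A] [NormedSpace ℝ A] [FiniteDimensional ℝ A]
  {G : GPT A}

/-- The product of a state with itself. -/
def productState (φ : StrongDual ℝ A) : A →ₗ[ℝ] A →ₗ[ℝ] ℝ :=
  LinearMap.mk₂ ℝ (fun a b => φ a * φ b) (by simp [add_mul]) (by simp [mul_assoc])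
    (by simp [mul_add]) (by simp [mul_left_comm])

theorem isBipartiteState_productState {φ : StrongDual ℝ A} (hφ : φ ∈ G.states) :
    IsBipartiteState G G (productState φ) where
  normalized := by simp [productState, G.state_apply_unit φ hφ]
  nonneg e he f hf := by
    simpa [productState] using mul_nonneg (he φ hφ).1 (hf φ hφ).1

variable (G) in
theorem GPT.exists_isMeasurementFamily (X X' : Type*) [Fintype X'] [Nonempty X'] :
    ∃ e : X' → X → A, G.IsMeasurementFamily e := by
  classical
  obtain ⟨a₀⟩ := ‹Nonempty X'›
  refine ⟨fun a _ => if a = a₀ then G.unit else 0, fun a x => ?_, fun x => by simp⟩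
  dsimp only
  split_ifs
  · exact G.unit_mem
  · simpa using G.unit_sub_mem _ G.unit_mem

variable (G) in
/-- Any finite number of states and effects of the GPT can be simulated in a finite-level quantum
system with error at most `ε`, by linear maps that preserve all states and effects. -/
def FinitelySimulable (ε : ℝ) : Prop :=
  ∀ s : Set (StrongDual ℝ A), s.Finite → s ⊆ G.states → ∀ t : Set A, t.Finite → t ⊆ G.effects →
    ∃ (n : ℕ) (Φ : A →ₗ[ℝ] selfAdjoint (Matrix (Fin n) (Fin n) ℂ))
      (Ψ : StrongDual ℝ A →ₗ[ℝ] selfAdjoint (Matrix (Fin n) (Fin n) ℂ)),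
      (∀ e ∈ G.effects, Φ e ∈ (quantumSystem n).effects) ∧
      (∀ φ ∈ G.states, Ψ φ ∈ (quantumSystem n).states) ∧
      ∀ φ ∈ s, ∀ e ∈ t, |φ e - (quantumSystem n).prob (Ψ φ) (Φ e)| ≤ ε

theorem FinitelySimulable.nonneg {ε : ℝ} (h : FinitelySimulable G ε) : 0 ≤ ε := by
  obtain ⟨φ, hφ⟩ := G.states_nonempty
  obtain ⟨n, Φ, Ψ, -, -, hc⟩ := h {φ} (Set.finite_singleton _) (by simpa using hφ) {G.unit}
    (Set.finite_singleton _) (by simpa using G.unit_mem)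
  exact (abs_nonneg _).trans (hc φ rfl _ rfl)

variable {X Y X' Y' : Type*} [Fintype X] [Fintype Y] [Fintype X'] [Fintype Y']

theorem FinitelySimulable.bellValue_sub_le [Nonempty X'] [Nonempty Y'] {ε : ℝ}
    (h : FinitelySimulable G ε) (β : X' → Y' → X → Y → ℝ) {P : X' → Y' → X → Y → ℝ}
    (hP : IsBehaviour G G P) {C : ℝ} (hC : 1 + 2 * selfEntangleability G < C) :
    bellValue β P - bellQuantum β ≤ bellNorm β * (2 * ε * C) := by
  obtain ⟨ω, e, f, hω, he, hf, hPω⟩ := hP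
  obtain ⟨r, ⟨k, c, φ, ψ, hφ, hψ, hdec, hc, rfl⟩, hrC⟩ := exists_decompositionWeight_lt G hω hC
  obtain ⟨n, Φ, Ψ, hΦ, hΨ, hcl⟩ := h (Set.range φ ∪ Set.range ψ)
    ((Set.finite_range _).union (Set.finite_range _))
    (by rintro _ (⟨i, rfl⟩ | ⟨i, rfl⟩); exacts [hφ i, hψ i])
    ((Set.range (fun p : X' × X => e p.1 p.2) ∪ Set.range fun p : Y' × Y => f p.1 p.2) ∪
      -- Complements are simulated too, as required by the completion of the measurements.
      (Set.range (fun p : X' × X => G.unit - e p.1 p.2) ∪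
        Set.range fun p : Y' × Y => G.unit - f p.1 p.2))
    (((Set.finite_range _).union (Set.finite_range _)).union
      ((Set.finite_range _).union (Set.finite_range _)))
    (by
      rintro _ ((⟨p, rfl⟩ | ⟨p, rfl⟩) | (⟨p, rfl⟩ | ⟨p, rfl⟩))
      exacts [he.1 _ _, hf.1 _ _, G.unit_sub_mem _ (he.1 _ _), G.unit_sub_mem _ (hf.1 _ _)])
  obtain ⟨Q, hQ, hPQ⟩ := exists_quantumBehaviour_close hΦ hΨ hω hφ hψ hdec hc he hf (ε := ε)
    (fun i a x => hcl _ (.inl ⟨i, rfl⟩) _ (.inl (.inl ⟨(a, x), rfl⟩)))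
    (fun i a x => hcl _ (.inl ⟨i, rfl⟩) _ (.inr (.inl ⟨(a, x), rfl⟩)))
    (fun i b y => hcl _ (.inr ⟨i, rfl⟩) _ (.inl (.inr ⟨(b, y), rfl⟩)))
    (fun i b y => hcl _ (.inr ⟨i, rfl⟩) _ (.inr (.inr ⟨(b, y), rfl⟩)))
  have h1 := GPTTheory.bellValue_sub_le β P Q fun a b x y => (hPω a b x y).symm ▸ hPQ a b x y
  have h2 := bellValue_le_bellQuantum β hQ
  have h3 : bellNorm β * (2 * ε * ∑ i, |c i|) ≤ bellNorm β * (2 * ε * C) :=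
    mul_le_mul_of_nonneg_left
      (mul_le_mul_of_nonneg_left hrC.le (mul_nonneg zero_le_two h.nonneg)) (bellNorm_nonneg β)
  linarith

theorem not_forall_finitelySimulable (β : X' → Y' → X → Y → ℝ)
    (hβ : bellMax G G β > bellQuantum β) {ε : ℝ}
    (hε : ε < (bellMax G G β - bellQuantum β) /
      (4 * bellNorm β * (1 + 2 * selfEntangleability G))) :
    ¬ ∀ ε' > ε, FinitelySimulable G ε' := by
  intro h
  have hε0 : 0 ≤ ε := le_of_forall_gt_imp_ge_of_dense fun ε' hε' => (h ε' hε').nonneg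
  have hB : 0 < bellNorm β := by
    -- If `|B| = 0`, the bound on `ε` is a division by zero, hence 0, which contradicts `0 ≤ ε`.
    refine (bellNorm_nonneg β).lt_of_ne fun h0 => ?_
    rw [← h0, mul_zero, zero_mul, div_zero] at hε
    exact hε.not_ge hε0
  have hX' : Nonempty X' := not_isEmpty_iff.1 fun _ => by simp [bellNorm] at hB
  have hY' : Nonempty Y' := not_isEmpty_iff.1 fun _ => by simp [bellNorm] at hB
  obtain ⟨φ, hφ⟩ := G.states_nonempty
  have hω := isBipartiteState_productState hφ
  have hK := one_le_one_add_two_mul_selfEntangleability G hω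
  obtain ⟨e, he⟩ := G.exists_isMeasurementFamily X X'
  obtain ⟨f, hf⟩ := G.exists_isMeasurementFamily Y Y'
  obtain ⟨_, ⟨P, hP, rfl⟩, hPlt⟩ := exists_lt_of_lt_csSup
    (s := {r | ∃ P : X' → Y' → X → Y → ℝ, IsBehaviour G G P ∧ r = bellValue β P})
    (b := bellMax G G β - (bellMax G G β - bellQuantum β) / 4)
    ⟨_, _, ⟨_, e, f, hω, he, hf, fun _ _ _ _ => rfl⟩, rfl⟩ (by
      change _ < bellMax G G β
      linarith)
  obtain ⟨ε', hε', hε''⟩ := exists_between hε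
  -- `P` keeps more than 3/4 of the gap, while this choice of `C` bounds what it keeps by `3 ε' |B|
  -- (1 + 2 R)`, which is less than 3/4 of the gap. The slack makes exact maximizers unnecessary.
  have h1 := (h ε' hε').bellValue_sub_le β hP
    (C := 3 / 2 * (1 + 2 * selfEntangleability G)) (by linarith)
  rw [lt_div_iff₀ (by positivity)] at hε''
  linarith

end Approximation

/-! ### Hilbert–Schmidt operators and convergence of truncated traces -/

section HilbertSchmidt

open Filter Topology

variable {ι H : Type*} [NormedAddCommGroup H] [InnerProductSpace ℂ H]

theorem hasSum_norm_inner_sq (b : HilbertBasis ι ℂ H) (x : H) :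
    HasSum (fun i => ‖⟪b i, x⟫_ℂ‖ ^ 2) (‖x‖ ^ 2) := by
  have h := Complex.hasSum_re (b.hasSum_inner_mul_inner x x)
  convert h using 1
  · ext i
    rw [← inner_conj_symm x (b i), Complex.conj_mul', ← Complex.ofReal_pow, Complex.ofReal_re]
  · exact norm_sq_eq_re_inner (𝕜 := ℂ) x

theorem summable_norm_inner_sq (b : HilbertBasis ι ℂ H) {T : H →L[ℂ] H}
    (hT : Summable fun i => ‖T (b i)‖ ^ 2) :
    Summable fun p : ι × ι => ‖⟪b p.2, T (b p.1)⟫_ℂ‖ ^ 2 := by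
  rw [summable_prod_of_nonneg fun _ => by positivity]
  refine ⟨fun i => (hasSum_norm_inner_sq b (T (b i))).summable, ?_⟩
  simpa only [(hasSum_norm_inner_sq b _).tsum_eq] using hT

/-- The orthogonal projection onto the span of finitely many elements of a basis. -/
def truncation (b : HilbertBasis ι ℂ H) (s : Finset ι) : H →L[ℂ] H :=
  ∑ i ∈ s, (innerSL ℂ (b i)).smulRight (b i)

theorem truncation_apply (b : HilbertBasis ι ℂ H) (s : Finset ι) (x : H) :
    truncation b s x = ∑ i ∈ s, ⟪b i, x⟫_ℂ • b i := by
  simp [truncation]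

theorem truncation_apply_basis (b : HilbertBasis ι ℂ H) [DecidableEq ι] (s : Finset ι) (i : ι) :
    truncation b s (b i) = if i ∈ s then b i else 0 := by
  simp [truncation_apply, orthonormal_iff_ite.1 b.orthonormal]

theorem norm_truncation_apply_le (b : HilbertBasis ι ℂ H) (s : Finset ι) (x : H) :
    ‖truncation b s x‖ ≤ ‖x‖ := by
  refine le_of_sq_le_sq ?_ (norm_nonneg _)
  rw [norm_sq_eq_re_inner (𝕜 := ℂ), truncation_apply, b.orthonormal.inner_sum]
  refine le_trans (le_of_eq ?_) (b.orthonormal.sum_inner_products_le x (s := s))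
  rw [map_sum]
  refine Finset.sum_congr rfl fun i _ => ?_
  rw [RCLike.conj_mul]
  norm_cast

theorem tendsto_truncation_apply (b : HilbertBasis ι ℂ H) (x : H) :
    Tendsto (fun s => truncation b s x) atTop (𝓝 x) := by
  simp only [truncation_apply]
  have := b.hasSum_repr x
  simp only [b.repr_apply_apply] at this
  exact this

variable [CompleteSpace H]

/-- The adjoint of a Hilbert–Schmidt operator is Hilbert–Schmidt. -/
theorem summable_norm_sq_adjoint (b : HilbertBasis ι ℂ H) {T : H →L[ℂ] H}
    (hT : Summable fun i => ‖T (b i)‖ ^ 2) :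
    Summable fun i => ‖ContinuousLinearMap.adjoint T (b i)‖ ^ 2 := by
  have h := (summable_norm_inner_sq b hT).prod_symm
  rw [summable_prod_of_nonneg fun _ => by positivity] at h
  convert h.2 using 2 with i
  rw [← (hasSum_norm_inner_sq b _).tsum_eq]
  refine tsum_congr fun k => ?_
  rw [ContinuousLinearMap.adjoint_inner_right, norm_inner_symm]
  rfl

/-- The Hilbert–Schmidt inner product of two operators equals that of their adjoints. -/
theorem tsum_inner_eq_tsum_inner_adjoint (b : HilbertBasis ι ℂ H) {S T : H →L[ℂ] H}
    (hS : Summable fun i => ‖S (b i)‖ ^ 2) (hT : Summable fun i => ‖T (b i)‖ ^ 2) :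
    ∑' i, ⟪S (b i), T (b i)⟫_ℂ =
      ∑' i, ⟪ContinuousLinearMap.adjoint T (b i), ContinuousLinearMap.adjoint S (b i)⟫_ℂ := by
  -- Absolute summability of the double series, by `x y ≤ x² + y²`, permits exchanging the sums.
  have hF : Summable (Function.uncurry fun i k => ⟪S (b i), b k⟫_ℂ * ⟪b k, T (b i)⟫_ℂ) := by
    refine .of_norm_bounded ((summable_norm_inner_sq b hS).add (summable_norm_inner_sq b hT)) ?_
    rintro ⟨i, k⟩
    simp only [Function.uncurry_apply_pair, norm_mul, norm_inner_symm (S (b i))]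
    nlinarith [sq_nonneg (‖⟪b k, S (b i)⟫_ℂ‖ - ‖⟪b k, T (b i)⟫_ℂ‖),
      sq_nonneg ‖⟪b k, S (b i)⟫_ℂ‖, sq_nonneg ‖⟪b k, T (b i)⟫_ℂ‖]
  calc ∑' i, ⟪S (b i), T (b i)⟫_ℂ = ∑' i, ∑' k, ⟪S (b i), b k⟫_ℂ * ⟪b k, T (b i)⟫_ℂ :=
        tsum_congr fun i => (b.tsum_inner_mul_inner _ _).symm
    _ = ∑' k, ∑' i, ⟪S (b i), b k⟫_ℂ * ⟪b k, T (b i)⟫_ℂ := hF.tsum_comm.symm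
    _ = _ := tsum_congr fun k => by
      rw [← b.tsum_inner_mul_inner]
      refine tsum_congr fun i => ?_
      rw [ContinuousLinearMap.adjoint_inner_right, ContinuousLinearMap.adjoint_inner_left, mul_comm]

/-- Cyclicity of the trace, for a product of two equal self-adjoint Hilbert–Schmidt operators and a
bounded self-adjoint one. -/
theorem tsum_inner_mul_mul_self (b : HilbertBasis ι ℂ H) {R E : H →L[ℂ] H}
    (hR : IsSelfAdjoint R) (hE : IsSelfAdjoint E) (hs : Summable fun i => ‖R (b i)‖ ^ 2) :
    ∑' i, ⟪b i, R (R (E (b i)))⟫_ℂ = ∑' i, ⟪E (R (b i)), R (b i)⟫_ℂ := by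
  have hRa : ContinuousLinearMap.adjoint R = R := hR.star_eq
  have hEa : ContinuousLinearMap.adjoint E = E := hE.star_eq
  have hER : Summable fun i => ‖(E ∘L R) (b i)‖ ^ 2 := by
    refine .of_nonneg_of_le (fun _ => by positivity) (fun i => ?_) (hs.mul_left (‖E‖ ^ 2))
    rw [← mul_pow]
    exact pow_le_pow_left₀ (norm_nonneg _) (E.le_opNorm _) 2
  have hadj : ContinuousLinearMap.adjoint (E ∘L R) = R ∘L E := by
    rw [ContinuousLinearMap.adjoint_comp, hRa, hEa]
  have hRE : Summable fun i => ‖(R ∘L E) (b i)‖ ^ 2 := hadj ▸ summable_norm_sq_adjoint b hER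
  have h := tsum_inner_eq_tsum_inner_adjoint b hs hRE
  rw [← hadj, ContinuousLinearMap.adjoint_adjoint, hRa, hadj] at h
  rw [← show ∑' i, ⟪R (b i), (R ∘L E) (b i)⟫_ℂ = ∑' i, ⟪b i, R (R (E (b i)))⟫_ℂ from
    tsum_congr fun i => ?_, h]
  · rfl
  · conv_lhs => rw [← hRa]
    rw [ContinuousLinearMap.adjoint_inner_left, hRa]
    rfl

theorem isSelfAdjoint_truncation (b : HilbertBasis ι ℂ H) (s : Finset ι) :
    IsSelfAdjoint (truncation b s) := by
  rw [ContinuousLinearMap.isSelfAdjoint_iff_isSymmetric]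
  intro x y
  simp only [ContinuousLinearMap.coe_coe, truncation_apply, sum_inner, inner_sum, inner_smul_left,
    inner_smul_right, inner_conj_symm]
  exact Finset.sum_congr rfl fun i _ => mul_comm _ _

/-- `tr (ρ P E P) → tr (ρ E)` for `ρ = R²` of trace class, as the projection `P` increases to the
identity. -/
theorem tendsto_sum_inner_mul_inner (b : HilbertBasis ι ℂ H) {R E : H →L[ℂ] H}
    (hR : IsSelfAdjoint R) (hE : IsSelfAdjoint E) (hs : Summable fun i => ‖R (b i)‖ ^ 2) :
    Tendsto (fun s : Finset ι => ∑ i ∈ s, ∑ j ∈ s, ⟪b i, R (R (b j))⟫_ℂ * ⟪b j, E (b i)⟫_ℂ) atTop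
      (𝓝 (∑' i, ⟪b i, R (R (E (b i)))⟫_ℂ)) := by
  classical
  -- Cyclicity, applied to `P E P`, moves the truncation between `E` and `R`. The terms are then
  -- dominated by `‖E‖ * ‖R (b k)‖ ^ 2`, independently of `s`.
  have key : ∀ s : Finset ι, ∑ i ∈ s, ∑ j ∈ s, ⟪b i, R (R (b j))⟫_ℂ * ⟪b j, E (b i)⟫_ℂ =
      ∑' k, ⟪E (truncation b s (R (b k))), truncation b s (R (b k))⟫_ℂ := by
    intro s
    have hP := isSelfAdjoint_truncation b s
    have hPa : ContinuousLinearMap.adjoint (truncation b s) = truncation b s := hP.star_eq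
    have hPEP : IsSelfAdjoint (truncation b s ∘L E ∘L truncation b s) := by
      rw [ContinuousLinearMap.isSelfAdjoint_iff', ContinuousLinearMap.adjoint_comp,
        ContinuousLinearMap.adjoint_comp, hPa, hE.adjoint_eq]
      rfl
    have h := tsum_inner_mul_mul_self b hR hPEP hs
    simp only [ContinuousLinearMap.comp_apply, truncation_apply_basis] at h
    rw [tsum_eq_sum (s := s) fun i hi => by simp [hi]] at h
    calc _ = ∑ i ∈ s, ⟪b i, R (R (truncation b s (E (if i ∈ s then b i else 0))))⟫_ℂ := by
          refine Finset.sum_congr rfl fun i hi => ?_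
          rw [if_pos hi, truncation_apply]
          simp only [map_sum, map_smul, inner_sum, inner_smul_right]
          exact Finset.sum_congr rfl fun j _ => mul_comm _ _
      _ = _ := h
      _ = _ := tsum_congr fun k => by
          conv_lhs => rw [← hPa, ContinuousLinearMap.adjoint_inner_left, hPa]
  rw [tsum_inner_mul_mul_self b hR hE hs]
  simp only [key]
  refine tendsto_tsum_of_dominated_convergence (bound := fun k => ‖E‖ * ‖R (b k)‖ ^ 2)
    (hs.mul_left _) (fun k => ?_) (.of_forall fun s k => ?_)
  · have h := tendsto_truncation_apply b (R (b k))
    exact ((E.continuous.tendsto _).comp h).inner h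
  · have h := norm_truncation_apply_le b s (R (b k))
    calc _ ≤ ‖E (truncation b s (R (b k)))‖ * ‖truncation b s (R (b k))‖ := norm_inner_le_norm _ _
      _ ≤ (‖E‖ * ‖R (b k)‖) * ‖R (b k)‖ := by
          gcongr
          exact (E.le_opNorm _).trans (by gcongr)
      _ = _ := by ring

end HilbertSchmidt

/-! ### Compression of operators to finite matrices -/

section Compression

variable {H : Type*} [NormedAddCommGroup H] [InnerProductSpace ℂ H] [CompleteSpace H] {n : ℕ}

/-- The compression of self-adjoint operators to the span of a family of vectors. -/
def compression (v : Fin n → H) :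
    selfAdjoint (H →L[ℂ] H) →ₗ[ℝ] selfAdjoint (Matrix (Fin n) (Fin n) ℂ) where
  toFun T := ⟨Matrix.of fun i j => ⟪v i, (T : H →L[ℂ] H) (v j)⟫_ℂ, by
    ext i j
    have hT : ContinuousLinearMap.adjoint (T : H →L[ℂ] H) = T := T.2.star_eq
    simp only [Matrix.star_apply, Matrix.of_apply]
    conv_rhs => rw [← hT, ContinuousLinearMap.adjoint_inner_right]
    exact inner_conj_symm _ _⟩
  map_add' S T := by
    ext i j
    simp
  map_smul' r T := by
    ext i j
    simp [inner_smul_right_eq_smul]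

theorem compression_apply (v : Fin n → H) (T : selfAdjoint (H →L[ℂ] H)) (i j : Fin n) :
    (compression v T : Matrix (Fin n) (Fin n) ℂ) i j = ⟪v i, (T : H →L[ℂ] H) (v j)⟫_ℂ := rfl

theorem posSemidef_compression (v : Fin n → H) {T : selfAdjoint (H →L[ℂ] H)}
    (hT : (T : H →L[ℂ] H).IsPositive) :
    (compression v T : Matrix (Fin n) (Fin n) ℂ).PosSemidef := by
  refine .of_dotProduct_mulVec_nonneg (compression v T).2 fun x => ?_
  convert hT.inner_nonneg_right (∑ i, x i • v i) using 1
  simp only [dotProduct, Matrix.mulVec, compression_apply, map_sum, map_smul, sum_inner, inner_sum,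
    inner_smul_left, inner_smul_right, Finset.mul_sum, Pi.star_apply]
  rw [Finset.sum_comm]
  refine Finset.sum_congr rfl fun i _ => Finset.sum_congr rfl fun j _ => ?_
  rw [starRingEnd_apply]
  ring

theorem compression_one {v : Fin n → H} (hv : Orthonormal ℂ v) :
    (compression v 1 : Matrix (Fin n) (Fin n) ℂ) = 1 := by
  ext i j
  rw [compression_apply]
  exact (orthonormal_iff_ite.1 hv i j).trans (Matrix.one_apply ..).symm

theorem compression_mem_effects {v : Fin n → H} (hv : Orthonormal ℂ v)
    {E : selfAdjoint (H →L[ℂ] H)} (hE : E ∈ (hilbertQuantumSystem H).effects) :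
    compression v E ∈ (quantumSystem n).effects := by
  refine ⟨posSemidef_compression v hE.1, ?_⟩
  have := posSemidef_compression v (T := 1 - E) (by simpa using hE.2)
  rwa [map_sub, AddSubgroupClass.coe_sub, compression_one hv] at this

end Compression

/-! ### Reduction of the Hilbert space case to finite dimension -/

section HilbertTruncation

open Filter Topology

variable {ι H : Type*} [NormedAddCommGroup H] [InnerProductSpace ℂ H]

/-- The elements of a Hilbert basis that belong to a finite index set, in some order. -/
def finiteSubfamily (b : HilbertBasis ι ℂ H) (s : Finset ι) (i : Fin s.card) : H :=
  b (s.equivFin.symm i : ι)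

theorem orthonormal_finiteSubfamily (b : HilbertBasis ι ℂ H) (s : Finset ι) :
    Orthonormal ℂ (finiteSubfamily b s) :=
  b.orthonormal.comp (fun i => (s.equivFin.symm i : ι))
    (Subtype.val_injective.comp s.equivFin.symm.injective)

theorem sum_finiteSubfamily {M : Type*} [AddCommMonoid M] (b : HilbertBasis ι ℂ H) (s : Finset ι)
    (F : H → M) : ∑ i, F (finiteSubfamily b s i) = ∑ i ∈ s, F (b i) := by
  rw [← Finset.sum_coe_sort s]
  exact s.equivFin.symm.sum_comp fun i : s => F (b i)

variable [CompleteSpace H]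

theorem trace_compression (b : HilbertBasis ι ℂ H) (s : Finset ι)
    (T : selfAdjoint (H →L[ℂ] H)) :
    (compression (finiteSubfamily b s) T : Matrix (Fin s.card) (Fin s.card) ℂ).trace =
      ∑ i ∈ s, ⟪b i, (T : H →L[ℂ] H) (b i)⟫_ℂ :=
  sum_finiteSubfamily b s fun x => ⟪x, (T : H →L[ℂ] H) x⟫_ℂ

theorem trace_compression_mul_compression (b : HilbertBasis ι ℂ H) (s : Finset ι)
    (T E : selfAdjoint (H →L[ℂ] H)) :
    ((compression (finiteSubfamily b s) T : Matrix (Fin s.card) (Fin s.card) ℂ) *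
      compression (finiteSubfamily b s) E).trace =
      ∑ i ∈ s, ∑ j ∈ s, ⟪b i, (T : H →L[ℂ] H) (b j)⟫_ℂ * ⟪b j, (E : H →L[ℂ] H) (b i)⟫_ℂ := by
  rw [← sum_finiteSubfamily b s fun x =>
    ∑ j ∈ s, ⟪x, (T : H →L[ℂ] H) (b j)⟫_ℂ * ⟪b j, (E : H →L[ℂ] H) x⟫_ℂ]
  exact Finset.sum_congr rfl fun i _ => sum_finiteSubfamily b s fun y =>
    ⟪finiteSubfamily b s i, (T : H →L[ℂ] H) y⟫_ℂ * ⟪y, (E : H →L[ℂ] H) (finiteSubfamily b s i)⟫_ℂ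

theorem hasSum_inner_of_mem_states {ρ : traceClassSelfAdjoint H}
    (hρ : ρ ∈ (hilbertQuantumSystem H).states) :
    HasSum (fun i => ⟪fixedBasis H i, (ρ : H →L[ℂ] H) (fixedBasis H i)⟫_ℂ) 1 := by
  have htr : opTrace (ρ : H →L[ℂ] H) = 1 := hρ.2.2
  have hs : Summable fun i => ⟪fixedBasis H i, (ρ : H →L[ℂ] H) (fixedBasis H i)⟫_ℂ := by
    -- A non-summable family has `tsum` equal to 0, not 1.
    by_contra h
    rw [opTrace, tsum_eq_zero_of_not_summable h] at htr
    exact zero_ne_one htr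
  rw [← htr]
  exact hs.hasSum

theorem tendsto_trace_compression_mul_compression {ρ : traceClassSelfAdjoint H}
    (hρ : ρ ∈ (hilbertQuantumSystem H).states) (E : selfAdjoint (H →L[ℂ] H)) :
    Tendsto (fun s => ((compression (finiteSubfamily (fixedBasis H) s) ρ :
      Matrix (Fin s.card) (Fin s.card) ℂ) *
      compression (finiteSubfamily (fixedBasis H) s) E).trace) atTop
      (𝓝 (opTrace ((ρ : H →L[ℂ] H) ∘L (E : H →L[ℂ] H)))) := by
  have hpos : (0 : H →L[ℂ] H) ≤ ρ := (ContinuousLinearMap.nonneg_iff_isPositive _).2 hρ.2.1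
  have hR : IsSelfAdjoint (CFC.sqrt (ρ : H →L[ℂ] H)) := .of_nonneg (CFC.sqrt_nonneg _)
  have hRR : ∀ x, CFC.sqrt (ρ : H →L[ℂ] H) (CFC.sqrt (ρ : H →L[ℂ] H) x) = (ρ : H →L[ℂ] H) x :=
    fun x => congrArg (fun T : H →L[ℂ] H => T x) (CFC.sqrt_mul_sqrt_self (ρ : H →L[ℂ] H) hpos)
  have hs : Summable fun i => ‖CFC.sqrt (ρ : H →L[ℂ] H) (fixedBasis H i)‖ ^ 2 := by
    convert (Complex.hasSum_re (hasSum_inner_of_mem_states hρ)).summable using 2 with i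
    rw [← hRR, norm_sq_eq_re_inner (𝕜 := ℂ)]
    conv_rhs => rw [← ContinuousLinearMap.adjoint_inner_left, hR.adjoint_eq]
    rfl
  have h := tendsto_sum_inner_mul_inner (fixedBasis H) hR E.2 hs
  simp only [hRR] at h
  simp only [trace_compression_mul_compression]
  exact h

/-- A rank-one density matrix. -/
def pureState {n : ℕ} (i : Fin n) : selfAdjoint (Matrix (Fin n) (Fin n) ℂ) :=
  ⟨Matrix.vecMulVec (Pi.single i 1) (star (Pi.single i 1)),
    (Matrix.posSemidef_vecMulVec_self_star _).1⟩

theorem pureState_mem_states {n : ℕ} (i : Fin n) : pureState i ∈ (quantumSystem n).states := by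
  refine ⟨Matrix.posSemidef_vecMulVec_self_star _, ?_⟩
  simp [pureState, Matrix.trace_vecMulVec]

/-- A linear map from states to matrices, normalized by adding the missing probability to a fixed
pure state. -/
def pureCompletion {A : Type*} [NormedAddCommGroup A] [NormedSpace ℝ A] {n : ℕ} (u : A)
    (Ψ : StrongDual ℝ A →ₗ[ℝ] selfAdjoint (Matrix (Fin n) (Fin n) ℂ)) (i : Fin n) :
    StrongDual ℝ A →ₗ[ℝ] selfAdjoint (Matrix (Fin n) (Fin n) ℂ) where
  -- The target trace 1 is written `φ u`, which equals 1 on states and is linear in `φ`.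
  toFun φ := Ψ φ + (φ u - (Ψ φ : Matrix (Fin n) (Fin n) ℂ).trace.re) • pureState i
  map_add' φ χ := by
    simp only [map_add, AddMemClass.coe_add, Matrix.trace_add, Complex.add_re, add_apply]
    module
  map_smul' r φ := by
    simp only [map_smul, selfAdjoint.val_smul, Matrix.trace_smul, Complex.real_smul,
      Complex.re_ofReal_mul, smul_apply, smul_eq_mul, RingHom.id_apply]
    module

theorem pureCompletion_apply {A : Type*} [NormedAddCommGroup A] [NormedSpace ℝ A] {n : ℕ} (u : A)
    (Ψ : StrongDual ℝ A →ₗ[ℝ] selfAdjoint (Matrix (Fin n) (Fin n) ℂ)) (i : Fin n)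
    (φ : StrongDual ℝ A) : (pureCompletion u Ψ i φ : Matrix (Fin n) (Fin n) ℂ) =
      Ψ φ + (φ u - (Ψ φ : Matrix (Fin n) (Fin n) ℂ).trace.re) •
        (pureState i : Matrix (Fin n) (Fin n) ℂ) := rfl

variable {A : Type*} [NormedAddCommGroup A] [NormedSpace ℝ A] [FiniteDimensional ℝ A] {G : GPT A}

/-- Compression maps effects to effects but loses the trace `δ φ r` of a state. Returning it as a
multiple of a pure state changes each probability by at most `δ φ r`, which tends to 0, so the room
between `ε` and `ε'` absorbs it. -/
theorem finitelySimulable_of_isEmbedding {ε ε' : ℝ} (hε : ε < ε')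
    {Φ : A →ₗ[ℝ] selfAdjoint (H →L[ℂ] H)} {Ψ : StrongDual ℝ A →ₗ[ℝ] traceClassSelfAdjoint H}
    (h : IsEmbedding G.toSystem (hilbertQuantumSystem H) ε Φ Ψ) : FinitelySimulable G ε' := by
  intro s hs hsG t ht htG
  have hΨ : ∀ φ ∈ G.states, Ψ φ ∈ (hilbertQuantumSystem H).states := h.map_states
  have hΦ : ∀ e ∈ G.effects, Φ e ∈ (hilbertQuantumSystem H).effects := h.map_effects
  let M (r : Finset (basisIndex H)) := compression (finiteSubfamily (fixedBasis H) r)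
  let δ (φ : StrongDual ℝ A) (r : Finset (basisIndex H)) : ℝ :=
    1 - (M r (Ψ φ) : Matrix (Fin r.card) (Fin r.card) ℂ).trace.re
  have hMre : ∀ (φ : StrongDual ℝ A) (r : Finset (basisIndex H)),
      (M r (Ψ φ) : Matrix (Fin r.card) (Fin r.card) ℂ).trace.re =
      ∑ i ∈ r, (⟪fixedBasis H i, (Ψ φ : H →L[ℂ] H) (fixedBasis H i)⟫_ℂ).re := fun φ r => by
    simp only [M, trace_compression, Complex.re_sum]
  have hδ0 : ∀ φ ∈ G.states, ∀ r, 0 ≤ δ φ r := by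
    intro φ hφ r
    have hsum := Complex.hasSum_re (hasSum_inner_of_mem_states (hΨ φ hφ))
    simp only [δ, hMre, sub_nonneg]
    exact sum_le_hasSum r
      (fun i _ => (Complex.le_def.1 ((hΨ φ hφ).2.1.inner_nonneg_right _)).1) hsum
  have hδ : ∀ φ ∈ G.states, Tendsto (δ φ) atTop (𝓝 0) := by
    intro φ hφ
    have hsum := Complex.hasSum_re (hasSum_inner_of_mem_states (hΨ φ hφ))
    have := (tendsto_const_nhds (x := (1 : ℝ))).sub hsum
    simp only [Complex.one_re, sub_self, SummationFilter.unconditional_filter] at this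
    simpa only [δ, hMre] using this
  -- The pure state needs an index; a state of trace one rules out an empty basis.
  have hne : ∀ᶠ r : Finset (basisIndex H) in atTop, r.Nonempty := by
    obtain ⟨φ, hφ⟩ := G.states_nonempty
    have : Nonempty (basisIndex H) := by
      by_contra hemp
      rw [not_nonempty_iff] at hemp
      have := (hasSum_inner_of_mem_states (hΨ φ hφ)).unique hasSum_empty
      exact one_ne_zero this
    obtain ⟨i⟩ := this
    filter_upwards [eventually_ge_atTop {i}] with r hr using ⟨i, hr (Finset.mem_singleton_self i)⟩
  have hlim : ∀ φ ∈ G.states, ∀ e ∈ G.effects, ∀ᶠ r : Finset (basisIndex H) in atTop,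
      |φ e - ((M r (Ψ φ) : Matrix (Fin r.card) (Fin r.card) ℂ) * M r (Φ e)).trace.re| + δ φ r <
        ε' := by
    intro φ hφ e he
    have h1 := (Complex.continuous_re.tendsto _).comp
      (tendsto_trace_compression_mul_compression (hΨ φ hφ) (Φ e))
    have h2 := ((tendsto_const_nhds (x := φ e)).sub h1).abs.add (hδ φ hφ)
    refine h2.eventually_lt_const ?_
    rw [add_zero]
    exact (h.prob_close e he φ hφ).trans_lt hε
  have hall : ∀ᶠ r : Finset (basisIndex H) in atTop, ∀ φ ∈ s, ∀ e ∈ t,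
      |φ e - ((M r (Ψ φ) : Matrix (Fin r.card) (Fin r.card) ℂ) * M r (Φ e)).trace.re| + δ φ r <
        ε' :=
    (eventually_all_finite hs).2 fun φ hφ => (eventually_all_finite ht).2 fun e he =>
      hlim φ (hsG hφ) e (htG he)
  obtain ⟨r, hr, hclose⟩ := (hne.and hall).exists
  let Ψ' := M r ∘ₗ (traceClassSelfAdjoint H).subtype ∘ₗ Ψ
  have hΨ' : ∀ φ, Ψ' φ = M r (Ψ φ) := fun _ => rfl
  let i₀ : Fin r.card := ⟨0, hr.card_pos⟩
  have hmE : ∀ e ∈ G.effects, M r (Φ e) ∈ (quantumSystem r.card).effects := fun e he =>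
    compression_mem_effects (orthonormal_finiteSubfamily _ _) (hΦ e he)
  have happ : ∀ φ ∈ G.states,
      (pureCompletion G.unit Ψ' i₀ φ :
        Matrix (Fin r.card) (Fin r.card) ℂ) = M r (Ψ φ) + δ φ r •
        (pureState i₀ : Matrix (Fin r.card) (Fin r.card) ℂ) := fun φ hφ => by
    rw [pureCompletion_apply, hΨ', G.state_apply_unit φ hφ]
  have hJ := pureState_mem_states i₀
  have hJtr : (pureState i₀ : Matrix (Fin r.card) (Fin r.card) ℂ).trace = 1 := hJ.2
  refine ⟨r.card, M r ∘ₗ Φ, pureCompletion G.unit Ψ' i₀,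
    hmE, fun φ hφ => ?_, fun φ hφ e he => ?_⟩
  · have hM := posSemidef_compression (finiteSubfamily (fixedBasis H) r) (hΨ φ hφ).2.1
    refine ⟨?_, ?_⟩
    · rw [happ φ hφ]
      exact hM.add (hJ.1.smul (hδ0 φ hφ r))
    · have htr := trace_mul_eq_ofReal hM.1 (Matrix.isHermitian_one (α := ℂ))
      rw [Matrix.mul_one] at htr
      rw [happ φ hφ, Matrix.trace_add, Matrix.trace_smul, hJtr]
      simp only [δ, M]
      rw [htr]
      simp
  · have h1 := hclose φ hφ e he
    have h2 := trace_mul_re_mem_Icc hJ.1 hJtr (hmE e (htG he)).1 (hmE e (htG he)).2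
    have h3 := hδ0 φ (hsG hφ) r
    simp only [quantumSystem, LinearMap.comp_apply]
    rw [happ φ (hsG hφ), Matrix.add_mul, Matrix.trace_add, Complex.add_re, Matrix.smul_mul,
      Matrix.trace_smul, Complex.real_smul, Complex.re_ofReal_mul, ← sub_sub]
    refine (abs_sub _ _).trans (le_trans (add_le_add_right ?_ _) h1.le)
    rw [abs_of_nonneg (mul_nonneg h3 h2.1)]
    exact mul_le_of_le_one_right h3 h2.2

end HilbertTruncation

theorem finitelySimulable_of_embeddable_quantumSystem {A : Type*} [NormedAddCommGroup A]
    [NormedSpace ℝ A] [FiniteDimensional ℝ A] {G : GPT A} {n : ℕ} {ε ε' : ℝ} (hε : ε ≤ ε')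
    (h : Embeddable G.toSystem (quantumSystem n) ε) : FinitelySimulable G ε' := by
  obtain ⟨Φ, Ψ, h⟩ := h
  exact fun s _ hs t _ ht => ⟨n, Φ, Ψ, h.map_effects, h.map_states, fun φ hφ e he =>
    (h.prob_close e (ht he) φ (hs hφ)).trans hε⟩

end GPTTheory

end

theorem theorem3 {A : Type*} [NormedAddCommGroup A] [NormedSpace ℝ A] [FiniteDimensional ℝ A]
    (G : GPTTheory.GPT A)
    {X Y X' Y' : Type*} [Fintype X] [Fintype Y] [Fintype X'] [Fintype Y']
    (β : X' → Y' → X → Y → ℝ)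
    (hβ : GPTTheory.bellMax G G β > GPTTheory.bellQuantum β)
    (ε : ℝ)
    (hε : ε < (GPTTheory.bellMax G G β - GPTTheory.bellQuantum β) /
      (4 * GPTTheory.bellNorm β * (1 + 2 * GPTTheory.selfEntangleability G))) :
    (∀ n : ℕ, ¬ GPTTheory.Embeddable G.toSystem (GPTTheory.quantumSystem n) ε) ∧
    (∀ (H : Type*) [NormedAddCommGroup H] [InnerProductSpace ℂ H] [CompleteSpace H]
      [TopologicalSpace.SeparableSpace H],
      ¬ GPTTheory.Embeddable G.toSystem (GPTTheory.hilbertQuantumSystem H) ε) := by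
  refine ⟨fun n h => GPTTheory.not_forall_finitelySimulable β hβ hε fun ε' hε' =>
    GPTTheory.finitelySimulable_of_embeddable_quantumSystem hε'.le h, ?_⟩
  intro H _ _ _ _ ⟨Φ, Ψ, h⟩
  exact GPTTheory.not_forall_finitelySimulable β hβ hε fun ε' hε' =>
    GPTTheory.finitelySimulable_of_isEmbedding hε' h
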